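/- Let $0<\alpha<1$ and let $\gamma:(0,\infty)\to\mathbb R$. Put $$\omega_{0,1}=\liminf_{t\to0^+}\frac{\ln|\gamma(t)|}{\ln t},\quad \omega_{0,2}=\limsup_{t\to0^+}\frac{\ln|\gamma(t)|}{\ln t},\quad \omega_{\infty,1}=\liminf_{t\to\infty}\frac{\ln|\gamma(t)|}{\ln t},\quad \omega_{\infty,2}=\limsup_{t\to\infty}\frac{\ln|\gamma(t)|}{\ln t}.$$ Assume hypothesis (H.): $\gamma\in C^2((0,\infty))$ is monotonic and nowhere zero, $\lim_{t\to0^+}\gamma(t)=\lim_{t\to0^+}\gamma'(t)=0$, $\omega_{\infty,1}\ge\omega_{0,2}$, $\omega_{0,1}>1$, and there are positive constants $C_1^{(1)},C_1^{(2)},C_2^{(1)}$ such that, for all $t>0$, $$\left|\frac{t\gamma'(t)}{\gamma(t)}\right|\le C_2^{(1)},\qquad \left|\frac{t^j\gamma^{(j)}(t)}{\gamma(t)}\right|\ge C_1^{(j)}\quad (j=1,2).$$ Assume moreover that $$\frac{\omega_{\infty,2}-\omega_{\infty,1}}{\omega_{\infty,2}-1}<\frac{\alpha}{1-\alpha}<\frac{\omega_{\infty,2}}{\omega_{\infty,2}-\omega_{\infty,1}+1}.$$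 Let $(\frac1p,\frac1q,\frac1r)$ lie in the open convex hull (the interior in $\mathbb R^3$ of the convex hull) of the points $$A(\alpha,0,0),\quad B(1,0,1-\alpha),\quad C_1\left(0,\tfrac{\alpha}{\omega_{\infty,1}},0\right),\quad C_2\left(0,\tfrac{\alpha}{\omega_{0,2}},0\right),\quad D_1\left(0,1,1-\tfrac{\alpha}{\omega_{\infty,1}}\right),\quad D_2\left(0,1,1-\tfrac{\alpha}{\omega_{0,2}}\right),$$ $$E\left(1,\tfrac{\omega_{\infty,2}-\alpha}{2\omega_{\infty,2}-\omega_{\infty,1}},\tfrac{2(\omega_{\infty,2}-\alpha)}{2\omega_{\infty,2}-\omega_{\infty,1}}\right),\quad F\left(\tfrac{\omega_{\infty,2}-\alpha}{2\omega_{\infty,2}-\omega_{\infty,1}},1,\tfrac{2(\omega_{\infty,2}-\alpha)}{2\omega_{\infty,2}-\omega_{\infty,1}}\right).$$ Then there is a constant $C>0$ such that for all $f\in L^p(\mathbb R)$ and $g\in L^q(\mathbb R)$ the integral $$H_{\alpha,\gamma}(f,g)(x)=\int_0^\infty f(x-t)\,g(x-\gamma(t))\,\frac{dt}{t^{1-\alpha}}$$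 converges absolutely for almost every $x\in\mathbb R$, the function $H_{\alpha,\gamma}(f,g)$ belongs to $L^r(\mathbb R)$, and $$\|H_{\alpha,\gamma}(f,g)\|_{L^r(\mathbb R)}\le C\,\|f\|_{L^p(\mathbb R)}\,\|g\|_{L^q(\mathbb R)}.$$ -/

import Mathlib

open Set Filter Topology MeasureTheory

noncomputable section

namespace BilinearCurve

/-- `ω_{0,1}`: lower limit of `ln |γ(t)| / ln t` as `t → 0⁺`. -/
def omegaZeroInf (γ : ℝ → ℝ) : ℝ :=
  liminf (fun t : ℝ => Real.log |γ t| / Real.log t) (𝓝[>] 0)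

/-- `ω_{0,2}`: upper limit of `ln |γ(t)| / ln t` as `t → 0⁺`. -/
def omegaZeroSup (γ : ℝ → ℝ) : ℝ :=
  limsup (fun t : ℝ => Real.log |γ t| / Real.log t) (𝓝[>] 0)

/-- `ω_{∞,1}`: lower limit of `ln |γ(t)| / ln t` as `t → ∞`. -/
def omegaInftyInf (γ : ℝ → ℝ) : ℝ :=
  liminf (fun t : ℝ => Real.log |γ t| / Real.log t) atTop

/-- `ω_{∞,2}`: upper limit of `ln |γ(t)| / ln t` as `t → ∞`. -/
def omegaInftySup (γ : ℝ → ℝ) : ℝ :=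
  limsup (fun t : ℝ => Real.log |γ t| / Real.log t) atTop

/-- Hypothesis (H.) on the curve `(t, γ(t))`, `t > 0`. Only the values of `γ` on `(0, ∞)` matter.
The lower bounds on `|t^j γ^{(j)}(t) / γ(t)|` force `γ(t) ≠ 0` for `t > 0` (a division by zero
would give `0`), and the upper bound on `|t γ'(t) / γ(t)|` makes `ln |γ(t)| / ln t` bounded
near `0⁺` and near `∞`, so that the four real lower and upper limits are the genuine ones. -/
structure CurveHypothesis (γ : ℝ → ℝ) : Prop where
  contDiffOn : ContDiffOn ℝ 2 γ (Ioi 0)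
  monotonic : MonotoneOn γ (Ioi 0) ∨ AntitoneOn γ (Ioi 0)
  tendsto_zero : Tendsto γ (𝓝[>] 0) (𝓝 0)
  tendsto_deriv_zero : Tendsto (deriv γ) (𝓝[>] 0) (𝓝 0)
  omegaZeroSup_le : omegaZeroSup γ ≤ omegaInftyInf γ
  one_lt_omegaZeroInf : 1 < omegaZeroInf γ
  upper_first : ∃ C : ℝ, 0 < C ∧ ∀ t : ℝ, 0 < t → |t * deriv γ t / γ t| ≤ C
  lower_first : ∃ C : ℝ, 0 < C ∧ ∀ t : ℝ, 0 < t → C ≤ |t * deriv γ t / γ t|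
  lower_second : ∃ C : ℝ, 0 < C ∧ ∀ t : ℝ, 0 < t → C ≤ |t ^ 2 * deriv (deriv γ) t / γ t|

/-- The integrand `f(x - t) g(x - γ(t)) / t^{1-α}`. -/
def integrand (α : ℝ) (γ : ℝ → ℝ) (f g : ℝ → ℂ) (x t : ℝ) : ℂ :=
  f (x - t) * g (x - γ t) / ((t ^ (1 - α) : ℝ) : ℂ)

/-- The bilinear fractional integral `H_{α,γ}(f,g)(x) = ∫₀^∞ f(x-t) g(x-γ(t)) dt / t^{1-α}`. -/
def bilinearFractionalIntegral (α : ℝ) (γ : ℝ → ℝ) (f g : ℝ → ℂ) (x : ℝ) : ℂ :=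
  ∫ t in Ioi (0 : ℝ), integrand α γ f g x t

/-- The common coordinate `(ω_{∞,2} - α) / (2 ω_{∞,2} - ω_{∞,1})` of the vertices `E` and `F`. -/
def vertexCoord (α : ℝ) (γ : ℝ → ℝ) : ℝ :=
  (omegaInftySup γ - α) / (2 * omegaInftySup γ - omegaInftyInf γ)

/-- The points `A, B, C₁, C₂, D₁, D₂, E, F`, in this order. -/
def vertices (α : ℝ) (γ : ℝ → ℝ) : Set (ℝ × ℝ × ℝ) :=
  {(α, 0, 0),
   (1, 0, 1 - α),
   (0, α / omegaInftyInf γ, 0),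
   (0, α / omegaZeroSup γ, 0),
   (0, 1, 1 - α / omegaInftyInf γ),
   (0, 1, 1 - α / omegaZeroSup γ),
   (1, vertexCoord α γ, 2 * vertexCoord α γ),
   (vertexCoord α γ, 1, 2 * vertexCoord α γ)}

/-- The open convex hull of the eight points. -/
def openHull (α : ℝ) (γ : ℝ → ℝ) : Set (ℝ × ℝ × ℝ) :=
  interior (convexHull ℝ (vertices α γ))

end BilinearCurve

end

noncomputable section

open scoped ENNReal

/-! ### Factorized bounds for positive bilinear operators: interpolation and summation -/

namespace BilinearCurve

/-! Absolute values reduce everything to a positive operator, and for positive operators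
interpolation is just Hölder's inequality in `t`. Bounds are kept in the factorized form `T(F^u,
G^v) ≤ K M^w` with `F`, `G`, `M` of integral at most one. This form interpolates pointwise and is
insensitive to whether the target exponent `r = 1/w` is below 1 (`w` reaches 2), where the triangle
inequality fails.

Since `γ''` has no zero and `γ'` tends to 0 at the origin, `γ'` has constant sign and `|γ'|`
increases, so `1 - γ'` vanishes at most at one point `t₀`. The half-line is cut into dyadic pieces
near 0, dyadic pieces near infinity, and two families of intervals shrinking towards `t₀`, each as
long as its distance to `t₀`. On a single piece there are elementary bounds at (0,0,0), (1,0,1),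
(0,1,1), (1,0,0), (0,1,0), (1,1,1) and (1,1,2). The point (1,1,1) comes from the change of variables
`(x - t, x - γ(t))`, whose Jacobian is `1 - γ'` up to sign; (1,1,2) comes from localization and
Cauchy–Schwarz (`lintegral_sqrt_setLIntegral_curve_le`).

The constants grow or decay like powers `2^(σk)`, with rates collected in `BasicGrowth`.
Interpolation gives rate at most 0 at all eight vertices, for each of the four families; the two
conditions on `α` are what E and F require near 0 and near infinity (`vertexCoord_bounds`). Hence
there is no growth on the whole hull, up to arbitrarily small losses. Each family also has a point
of genuine decay. An interior point `P` lies strictly between that point and another point of the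
hull, so the constants decay geometrically at `P` and the pieces can be summed
(`exists_boundedAt_tsum`, `CurveHypothesis.exists_boundedAt`). Finally `BoundedAt.norm_le` turns the
factorized bound into the norm inequality. -/

/-- The positive bilinear operator `∫ F(x - t) G(x - γ(t)) dμ(t)`. -/
def curveOp (γ : ℝ → ℝ) (μ : Measure ℝ) (F G : ℝ → ℝ≥0∞) (x : ℝ) : ℝ≥0∞ :=
  ∫⁻ t, F (x - t) * G (x - γ t) ∂μ

/-- `T` maps `L^{1/u} × L^{1/v}` to `L^{1/w}` with constant `K`, where `Q = (u, v, w)`. Nonnegative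
functions are written as powers of functions of integral at most one, so that zero exponents
(that is, `L^∞`) need no separate treatment. -/
def BoundedAt (T : (ℝ → ℝ≥0∞) → (ℝ → ℝ≥0∞) → ℝ → ℝ≥0∞) (K : ℝ) (Q : ℝ × ℝ × ℝ) : Prop :=
  ∀ F G : ℝ → ℝ≥0∞, Measurable F → Measurable G → ∫⁻ x, F x ≤ 1 → ∫⁻ x, G x ≤ 1 →
    ∃ M : ℝ → ℝ≥0∞, Measurable M ∧ ∫⁻ x, M x ≤ 1 ∧
      ∀ x, T (fun y => F y ^ Q.1) (fun y => G y ^ Q.2.1) x ≤ ENNReal.ofReal K * M x ^ Q.2.2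

theorem BoundedAt.mono {T : (ℝ → ℝ≥0∞) → (ℝ → ℝ≥0∞) → ℝ → ℝ≥0∞} {K K' : ℝ} {Q : ℝ × ℝ × ℝ}
    (h : BoundedAt T K Q) (hK : K ≤ K') : BoundedAt T K' Q := by
  intro F G hF hG hF1 hG1
  obtain ⟨M, hM, hM1, hT⟩ := h F G hF hG hF1 hG1
  exact ⟨M, hM, hM1, fun x => (hT x).trans (by gcongr)⟩

theorem ennreal_geom_mean_le {a b : ℝ} (ha : 0 ≤ a) (hb : 0 ≤ b) (hab : a + b = 1) (x y : ℝ≥0∞) :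
    x ^ a * y ^ b ≤ ENNReal.ofReal a * x + ENNReal.ofReal b * y := by
  rcases eq_or_lt_of_le ha with rfl | ha
  · obtain rfl : b = 1 := by linarith
    simp
  rcases eq_or_lt_of_le hb with rfl | hb
  · obtain rfl : a = 1 := by linarith
    simp
  by_cases hx : x = ⊤
  · simp [hx, ha, ENNReal.mul_top]
  by_cases hy : y = ⊤
  · simp [hy, hb, ENNReal.mul_top]
  lift x to NNReal using hx
  lift y to NNReal using hy
  have := NNReal.geom_mean_le_arith_mean2_weighted a.toNNReal b.toNNReal x y
    (by rw [← Real.toNNReal_add ha.le hb.le, hab, Real.toNNReal_one])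
  rw [Real.coe_toNNReal _ ha.le, Real.coe_toNNReal _ hb.le] at this
  rw [← ENNReal.coe_rpow_of_nonneg _ ha.le, ← ENNReal.coe_rpow_of_nonneg _ hb.le]
  simp only [ENNReal.ofReal]
  exact_mod_cast this

/-- The integrand on the left is the `a`-th power of one integrand times the `b`-th power of the
other, so this is Hölder's inequality in `t` with exponents `1/a` and `1/b`. -/
theorem curveOp_interpolate {γ : ℝ → ℝ} (hγ : Measurable γ) (μ : Measure ℝ)
    {F G : ℝ → ℝ≥0∞} (hF : Measurable F) (hG : Measurable G)
    {u₀ u₁ v₀ v₁ a b : ℝ} (hu₀ : 0 ≤ u₀) (hu₁ : 0 ≤ u₁) (hv₀ : 0 ≤ v₀) (hv₁ : 0 ≤ v₁)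
    (ha : 0 ≤ a) (hb : 0 ≤ b) (hab : a + b = 1) (x : ℝ) :
    curveOp γ μ (fun y => F y ^ (a * u₀ + b * u₁)) (fun y => G y ^ (a * v₀ + b * v₁)) x ≤
      curveOp γ μ (fun y => F y ^ u₀) (fun y => G y ^ v₀) x ^ a *
        curveOp γ μ (fun y => F y ^ u₁) (fun y => G y ^ v₁) x ^ b := by
  unfold curveOp
  have hF' : Measurable fun t => F (x - t) := hF.comp (measurable_const.sub measurable_id)
  have hG' : Measurable fun t => G (x - γ t) := hG.comp (measurable_const.sub hγ)
  refine le_trans (le_of_eq ?_) (ENNReal.lintegral_mul_norm_pow_le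
    (((hF'.pow_const u₀).mul (hG'.pow_const v₀)).aemeasurable)
    (((hF'.pow_const u₁).mul (hG'.pow_const v₁)).aemeasurable) ha hb hab)
  refine lintegral_congr fun t => ?_
  simp only [Pi.mul_apply]
  rw [ENNReal.rpow_add_of_nonneg _ _ (by positivity) (by positivity),
    ENNReal.rpow_add_of_nonneg _ _ (by positivity) (by positivity),
    ENNReal.mul_rpow_of_nonneg _ _ ha, ENNReal.mul_rpow_of_nonneg _ _ hb,
    mul_comm a, mul_comm b, mul_comm a, mul_comm b]
  simp only [ENNReal.rpow_mul]
  ring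

theorem BoundedAt.interpolate {γ : ℝ → ℝ} (hγ : Measurable γ) {μ : Measure ℝ}
    {K₀ K₁ : ℝ} (hK₀ : 0 < K₀) (hK₁ : 0 < K₁) {Q₀ Q₁ : ℝ × ℝ × ℝ} (hQ₀ : 0 ≤ Q₀) (hQ₁ : 0 ≤ Q₁)
    (h₀ : BoundedAt (curveOp γ μ) K₀ Q₀) (h₁ : BoundedAt (curveOp γ μ) K₁ Q₁)
    {a b : ℝ} (ha : 0 ≤ a) (hb : 0 ≤ b) (hab : a + b = 1) :
    BoundedAt (curveOp γ μ) (K₀ ^ a * K₁ ^ b) (a • Q₀ + b • Q₁) := by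
  obtain ⟨u₀, v₀, w₀⟩ := Q₀
  obtain ⟨u₁, v₁, w₁⟩ := Q₁
  simp only [Prod.le_def, Prod.fst_zero, Prod.snd_zero] at hQ₀ hQ₁
  obtain ⟨hu₀, hv₀, hw₀⟩ := hQ₀
  obtain ⟨hu₁, hv₁, hw₁⟩ := hQ₁
  intro F G hF hG hF1 hG1
  obtain ⟨M₀, hM₀, hM₀1, hT₀⟩ := h₀ F G hF hG hF1 hG1
  obtain ⟨M₁, hM₁, hM₁1, hT₁⟩ := h₁ F G hF hG hF1 hG1
  simp only [Prod.smul_mk, Prod.mk_add_mk, smul_eq_mul] at *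
  have key : ∀ x, curveOp γ μ (fun y => F y ^ (a * u₀ + b * u₁))
      (fun y => G y ^ (a * v₀ + b * v₁)) x ≤
      ENNReal.ofReal (K₀ ^ a * K₁ ^ b) * (M₀ x ^ (a * w₀) * M₁ x ^ (b * w₁)) := by
    intro x
    refine (curveOp_interpolate hγ μ hF hG hu₀ hu₁ hv₀ hv₁ ha hb hab x).trans ?_
    refine (mul_le_mul' (ENNReal.rpow_le_rpow (hT₀ x) ha)
      (ENNReal.rpow_le_rpow (hT₁ x) hb)).trans (le_of_eq ?_)
    rw [ENNReal.mul_rpow_of_nonneg _ _ ha, ENNReal.mul_rpow_of_nonneg _ _ hb,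
      ENNReal.ofReal_mul (by positivity), ENNReal.ofReal_rpow_of_pos hK₀,
      ENNReal.ofReal_rpow_of_pos hK₁, ← ENNReal.rpow_mul, ← ENNReal.rpow_mul, mul_comm w₀,
      mul_comm w₁]
    ring
  have h0 : 0 ≤ a * w₀ := by positivity
  have h1 : 0 ≤ b * w₁ := by positivity
  rcases eq_or_lt_of_le (add_nonneg h0 h1) with hw | hw
  · have e0 : a * w₀ = 0 := by linarith
    have e1 : b * w₁ = 0 := by linarith
    refine ⟨M₀, hM₀, hM₀1, fun x => (key x).trans ?_⟩
    simp [e0, e1]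
  -- The weighted arithmetic mean of `M₀` and `M₁` still has integral at most one and dominates the
  -- geometric mean that Hölder produces.
  · set w := a * w₀ + b * w₁
    have hc : a * w₀ / w + b * w₁ / w = 1 := by
      rw [← add_div]; exact div_self hw.ne'
    refine ⟨fun x => ENNReal.ofReal (a * w₀ / w) * M₀ x + ENNReal.ofReal (b * w₁ / w) * M₁ x,
      (hM₀.const_mul _).add (hM₁.const_mul _), ?_, fun x => (key x).trans ?_⟩
    · rw [lintegral_add_left (hM₀.const_mul _), lintegral_const_mul _ hM₀,
        lintegral_const_mul _ hM₁]
      calc _ ≤ ENNReal.ofReal (a * w₀ / w) * 1 + ENNReal.ofReal (b * w₁ / w) * 1 := by gcongr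
        _ = 1 := by
          rw [mul_one, mul_one, ← ENNReal.ofReal_add (by positivity) (by positivity), hc,
            ENNReal.ofReal_one]
    · gcongr
      refine le_trans (le_of_eq ?_) (ENNReal.rpow_le_rpow (ennreal_geom_mean_le
        (div_nonneg h0 hw.le) (div_nonneg h1 hw.le) hc (M₀ x) (M₁ x)) hw.le)
      rw [ENNReal.mul_rpow_of_nonneg _ _ hw.le, ← ENNReal.rpow_mul, ← ENNReal.rpow_mul,
        div_mul_cancel₀ _ hw.ne', div_mul_cancel₀ _ (ne_of_gt hw)]

/-- Geometrically decaying bounds can be summed, for every target exponent. -/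
theorem BoundedAt.tsum {T : ℕ → (ℝ → ℝ≥0∞) → (ℝ → ℝ≥0∞) → ℝ → ℝ≥0∞} {K τ : ℝ} (hK : 0 < K)
    (hτ0 : 0 < τ) (hτ1 : τ < 1) {Q : ℝ × ℝ × ℝ} (hQ : 0 ≤ Q.2.2)
    (h : ∀ k, BoundedAt (T k) (K * τ ^ k) Q) :
    ∃ K' : ℝ, 0 < K' ∧ BoundedAt (fun F G x => ∑' k, T k F G x) K' Q := by
  obtain ⟨u, v, w⟩ := Q
  simp only at hQ
  -- With `σ^(w+1) = τ`, the factor `τ^k` splits as `σ^k (σ^k)^w`: the first part makes the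
  -- constants summable, the second is absorbed into the weights `(1 - σ)σ^k` of the combined
  -- majorant.
  set σ : ℝ := τ ^ (1 / (w + 1)) with hσ
  have hσ0 : 0 < σ := Real.rpow_pos_of_pos hτ0 _
  have hσ1 : σ < 1 := Real.rpow_lt_one hτ0.le hτ1 (by positivity)
  have hστ : σ ^ (w + 1) = τ := by
    rw [hσ, ← Real.rpow_mul hτ0.le, one_div_mul_cancel (by positivity), Real.rpow_one]
  have hc : 0 < 1 - σ := by linarith
  have hgeom : ∀ A : ℝ, 0 ≤ A → ∑' k : ℕ, ENNReal.ofReal (A * σ ^ k) =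
      ENNReal.ofReal (A * (1 - σ)⁻¹) := by
    intro A hA
    rw [← ENNReal.ofReal_tsum_of_nonneg (fun k => by positivity)
      ((summable_geometric_of_lt_one hσ0.le hσ1).mul_left A), tsum_mul_left,
      tsum_geometric_of_lt_one hσ0.le hσ1]
  refine ⟨K * (1 - σ) ^ (-w) * (1 - σ)⁻¹, by positivity, ?_⟩
  intro F G hF hG hF1 hG1
  choose M hM hM1 hT using fun k => h k F G hF hG hF1 hG1
  refine ⟨fun x => ∑' k, ENNReal.ofReal ((1 - σ) * σ ^ k) * M k x,
    Measurable.tsum fun k => (hM k).const_mul _, ?_, fun x => ?_⟩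
  · rw [lintegral_tsum fun k => ((hM k).const_mul _).aemeasurable]
    calc ∑' k, ∫⁻ x, ENNReal.ofReal ((1 - σ) * σ ^ k) * M k x
        ≤ ∑' k, ENNReal.ofReal ((1 - σ) * σ ^ k) := by
          refine ENNReal.tsum_le_tsum fun k => ?_
          rw [lintegral_const_mul _ (hM k)]
          exact (mul_le_mul_right (hM1 k) _).trans (by simp)
      _ = 1 := by rw [hgeom _ hc.le, mul_inv_cancel₀ hc.ne', ENNReal.ofReal_one]
  · simp only at hT ⊢
    rw [← hgeom _ (by positivity), ← ENNReal.tsum_mul_right]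
    refine ENNReal.tsum_le_tsum fun k => (hT k x).trans ?_
    have hpos : 0 < (1 - σ) * σ ^ k := by positivity
    have hconst : K * τ ^ k = K * (1 - σ) ^ (-w) * σ ^ k * ((1 - σ) * σ ^ k) ^ w := by
      have e1 : τ ^ k = σ ^ k * (σ ^ k) ^ w := by
        rw [← hστ, ← Real.rpow_natCast, ← Real.rpow_natCast σ, ← Real.rpow_mul hσ0.le,
          ← Real.rpow_mul hσ0.le, ← Real.rpow_add hσ0]
        congr 1; ring
      rw [e1, Real.mul_rpow hc.le (by positivity), Real.rpow_neg hc.le]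
      have : (1 - σ) ^ w ≠ 0 := by positivity
      field_simp
    rw [hconst, ENNReal.ofReal_mul (by positivity), mul_assoc,
      ← ENNReal.ofReal_rpow_of_pos hpos, ← ENNReal.mul_rpow_of_nonneg _ _ hQ]
    gcongr
    exact ENNReal.le_tsum (f := fun k => ENNReal.ofReal ((1 - σ) * σ ^ k) * M k x) k

theorem BoundedAt.add {T₁ T₂ : (ℝ → ℝ≥0∞) → (ℝ → ℝ≥0∞) → ℝ → ℝ≥0∞} {Q : ℝ × ℝ × ℝ}
    (hQ : 0 ≤ Q.2.2) (h₁ : ∃ K : ℝ, 0 < K ∧ BoundedAt T₁ K Q)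
    (h₂ : ∃ K : ℝ, 0 < K ∧ BoundedAt T₂ K Q) :
    ∃ K : ℝ, 0 < K ∧ BoundedAt (fun F G x => T₁ F G x + T₂ F G x) K Q := by
  obtain ⟨K₁, hK₁, h₁⟩ := h₁
  obtain ⟨K₂, hK₂, h₂⟩ := h₂
  refine ⟨(K₁ + K₂) * 2 ^ Q.2.2, by positivity, ?_⟩
  intro F G hF hG hF1 hG1
  obtain ⟨M₁, hM₁, hM₁1, hT₁⟩ := h₁ F G hF hG hF1 hG1
  obtain ⟨M₂, hM₂, hM₂1, hT₂⟩ := h₂ F G hF hG hF1 hG1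
  refine ⟨fun x => 2⁻¹ * (M₁ x + M₂ x), (hM₁.add hM₂).const_mul _, ?_, fun x => ?_⟩
  · simp only
    rw [lintegral_const_mul _ (by fun_prop), lintegral_add_left hM₁]
    calc _ ≤ (2⁻¹ : ℝ≥0∞) * (1 + 1) := by gcongr
      _ = 1 := by rw [one_add_one_eq_two, ENNReal.inv_mul_cancel (by simp) (by simp)]
  · have e : ENNReal.ofReal ((K₁ + K₂) * 2 ^ Q.2.2) * (2⁻¹ * (M₁ x + M₂ x)) ^ Q.2.2 =
        (ENNReal.ofReal K₁ + ENNReal.ofReal K₂) * (M₁ x + M₂ x) ^ Q.2.2 := by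
      rw [ENNReal.ofReal_mul (by positivity), ← ENNReal.ofReal_rpow_of_pos (by norm_num),
        mul_assoc, ← ENNReal.mul_rpow_of_nonneg _ _ hQ, ← mul_assoc, ENNReal.ofReal_ofNat,
        ENNReal.mul_inv_cancel (by simp) (by simp), one_mul,
        ENNReal.ofReal_add hK₁.le hK₂.le]
    simp only
    rw [e, add_mul]
    refine add_le_add ((hT₁ x).trans ?_) ((hT₂ x).trans ?_)
    · gcongr; exact le_self_add
    · gcongr; exact le_add_self

/-- The operators `curveOp γ (μ k)` are bounded at `Q` with constants growing no faster than
`2 ^ (σ k)`, up to arbitrarily small losses in `σ`. -/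
def GrowthAt (γ : ℝ → ℝ) (μ : ℕ → Measure ℝ) (σ : ℝ) (Q : ℝ × ℝ × ℝ) : Prop :=
  0 ≤ Q ∧ ∀ ε : ℝ, 0 < ε → ∃ K : ℝ, 0 < K ∧
    ∀ k : ℕ, BoundedAt (curveOp γ (μ k)) (K * 2 ^ ((σ + ε) * k)) Q

theorem GrowthAt.mono {γ : ℝ → ℝ} {μ : ℕ → Measure ℝ} {σ σ' : ℝ} {Q : ℝ × ℝ × ℝ}
    (h : GrowthAt γ μ σ Q) (hσ : σ ≤ σ') : GrowthAt γ μ σ' Q := by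
  refine ⟨h.1, fun ε hε => ?_⟩
  obtain ⟨K, hK, hB⟩ := h.2 ε hε
  refine ⟨K, hK, fun k => (hB k).mono ?_⟩
  gcongr
  norm_num

theorem GrowthAt.interpolate {γ : ℝ → ℝ} (hγ : Measurable γ) {μ : ℕ → Measure ℝ} {σ₀ σ₁ : ℝ}
    {Q₀ Q₁ : ℝ × ℝ × ℝ} (h₀ : GrowthAt γ μ σ₀ Q₀) (h₁ : GrowthAt γ μ σ₁ Q₁)
    {a b : ℝ} (ha : 0 ≤ a) (hb : 0 ≤ b) (hab : a + b = 1) :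
    GrowthAt γ μ (a * σ₀ + b * σ₁) (a • Q₀ + b • Q₁) := by
  refine ⟨add_nonneg (smul_nonneg ha h₀.1) (smul_nonneg hb h₁.1), fun ε hε => ?_⟩
  obtain ⟨K₀, hK₀, hB₀⟩ := h₀.2 ε hε
  obtain ⟨K₁, hK₁, hB₁⟩ := h₁.2 ε hε
  refine ⟨K₀ ^ a * K₁ ^ b, by positivity, fun k => ?_⟩
  refine (BoundedAt.interpolate hγ (by positivity) (by positivity) h₀.1 h₁.1 (hB₀ k) (hB₁ k)
    ha hb hab).mono (le_of_eq ?_)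
  have h2 : (0 : ℝ) ≤ 2 := by norm_num
  have e : (a * σ₀ + b * σ₁ + ε) * k = (σ₀ + ε) * k * a + (σ₁ + ε) * k * b := by
    linear_combination (-(ε * k)) * hab
  rw [Real.mul_rpow hK₀.le (by positivity), Real.mul_rpow hK₁.le (by positivity),
    ← Real.rpow_mul h2, ← Real.rpow_mul h2, e, Real.rpow_add (by norm_num)]
  ring

/-- In the interior of a convex hull on which there is no growth, one point of decay (anywhere)
forces decay, so that the pieces can be summed. -/
theorem exists_boundedAt_tsum {γ : ℝ → ℝ} (hγ : Measurable γ) {μ : ℕ → Measure ℝ}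
    {V : Set (ℝ × ℝ × ℝ)} (hV : ∀ Q ∈ V, GrowthAt γ μ 0 Q) {σ : ℝ} (hσ : σ < 0)
    {Q₁ : ℝ × ℝ × ℝ} (hQ₁ : GrowthAt γ μ σ Q₁) {P : ℝ × ℝ × ℝ}
    (hP : P ∈ interior (convexHull ℝ V)) :
    ∃ K : ℝ, 0 < K ∧ BoundedAt (fun F G x => ∑' k, curveOp γ (μ k) F G x) K P := by
  have hconv : Convex ℝ {Q | GrowthAt γ μ 0 Q} := by
    intro Q hQ Q' hQ' a b ha hb hab
    simpa using GrowthAt.interpolate hγ hQ hQ' ha hb hab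
  have hhull : convexHull ℝ V ⊆ {Q | GrowthAt γ μ 0 Q} := convexHull_min hV hconv
  -- Moving slightly away from `Q₁` keeps `P` inside the hull, so `P` is a convex combination of a
  -- hull point and `Q₁` with positive weight on `Q₁`; `Q₁` itself need not lie in the hull.
  have hcont : Tendsto (fun s : ℝ => P + s • (P - Q₁)) (𝓝[>] 0) (𝓝 P) := by
    have : Continuous fun s : ℝ => P + s • (P - Q₁) := by fun_prop
    simpa using (this.tendsto 0).mono_left nhdsWithin_le_nhds
  obtain ⟨s, hsP, hs⟩ := ((hcont.eventually (mem_interior_iff_mem_nhds.1 hP)).and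
    self_mem_nhdsWithin).exists
  replace hs : 0 < s := hs
  have hs1 : 0 < 1 + s := by linarith
  have hdec := GrowthAt.interpolate hγ (hhull hsP) hQ₁ (a := 1 / (1 + s)) (b := s / (1 + s))
    (by positivity) (by positivity) (by field_simp)
  have hPe : (1 / (1 + s)) • (P + s • (P - Q₁)) + (s / (1 + s)) • Q₁ = P := by
    have : P + s • (P - Q₁) + s • Q₁ = (1 + s) • P := by module
    rw [div_eq_inv_mul s, mul_smul, one_div, ← smul_add, this, smul_smul,
      inv_mul_cancel₀ hs1.ne', one_smul]
  rw [hPe, mul_zero, zero_add] at hdec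
  have hneg : s / (1 + s) * σ < 0 := mul_neg_of_pos_of_neg (by positivity) hσ
  set ρ := s / (1 + s) * σ
  -- Half of the decay rate pays for the loss `ε`; ratio `2^(ρ/2) < 1` remains.
  obtain ⟨K, hK, hB⟩ := hdec.2 (-ρ / 2) (by linarith)
  refine BoundedAt.tsum hK (τ := 2 ^ (ρ / 2)) (by positivity)
    (Real.rpow_lt_one_of_one_lt_of_neg (by norm_num) (by linarith)) hdec.1.2.2 fun k => ?_
  refine (hB k).mono (le_of_eq ?_)
  rw [← Real.rpow_natCast, ← Real.rpow_mul (by norm_num)]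
  congr 2; ring

/-! ### Change of variables along the curve and the L¹ × L¹ estimates -/

theorem setLIntegral_comp_le {S : Set ℝ} (hS : MeasurableSet S) {φ φ' : ℝ → ℝ}
    (hφ : ∀ t ∈ S, HasDerivWithinAt φ (φ' t) S t) (hinj : InjOn φ S) {m : ℝ} (hm : 0 < m)
    (hmφ : ∀ t ∈ S, m ≤ |φ' t|) (h : ℝ → ℝ≥0∞) :
    ∫⁻ t in S, h (φ t) ≤ ENNReal.ofReal m⁻¹ * ∫⁻ x, h x := by
  have hm0 : ENNReal.ofReal m⁻¹ * ENNReal.ofReal m = 1 := by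
    rw [← ENNReal.ofReal_mul (by positivity), inv_mul_cancel₀ hm.ne', ENNReal.ofReal_one]
  calc ∫⁻ t in S, h (φ t)
      = ENNReal.ofReal m⁻¹ * ∫⁻ t in S, ENNReal.ofReal m * h (φ t) := by
        rw [lintegral_const_mul' _ _ ENNReal.ofReal_ne_top, ← mul_assoc, hm0, one_mul]
    _ ≤ ENNReal.ofReal m⁻¹ * ∫⁻ t in S, ENNReal.ofReal |φ' t| * h (φ t) := by
        gcongr ENNReal.ofReal m⁻¹ * ?_
        refine setLIntegral_mono' hS fun t ht => ?_
        gcongr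
        exact hmφ t ht
    _ = ENNReal.ofReal m⁻¹ * ∫⁻ x in φ '' S, h x := by
        rw [lintegral_image_eq_lintegral_abs_deriv_mul hS hφ hinj]
    _ ≤ _ := by gcongr; exact Measure.restrict_le_self

theorem measurable_setLIntegral_comp_sub {F : ℝ → ℝ≥0∞} (hF : Measurable F) {φ : ℝ → ℝ}
    (hφ : Measurable φ) (S : Set ℝ) : Measurable fun x => ∫⁻ t in S, F (x - φ t) :=
  Measurable.lintegral_prod_right' (f := fun p : ℝ × ℝ => F (p.1 - φ p.2)) (by fun_prop)

theorem lintegral_setLIntegral_comp_sub {F : ℝ → ℝ≥0∞} (hF : Measurable F) {φ : ℝ → ℝ}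
    (hφ : Measurable φ) (S : Set ℝ) :
    ∫⁻ x, ∫⁻ t in S, F (x - φ t) = volume S * ∫⁻ x, F x := by
  rw [lintegral_lintegral_swap (by fun_prop)]
  simp only [lintegral_sub_right_eq_self F]
  rw [setLIntegral_const, mul_comm]

theorem measurable_setLIntegral_curve {F G : ℝ → ℝ≥0∞} (hF : Measurable F) (hG : Measurable G)
    {γ : ℝ → ℝ} (hγ : Measurable γ) (S : Set ℝ) :
    Measurable fun x => ∫⁻ t in S, F (x - t) * G (x - γ t) :=
  Measurable.lintegral_prod_right' (f := fun p : ℝ × ℝ => F (p.1 - p.2) * G (p.1 - γ p.2))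
    (by fun_prop)

/-- Translating `x` by `t` leaves `G` evaluated at `y + (t - γ(t))`. For fixed `y` the map `t ↦ t -
γ(t)` is injective with derivative at least `n` in absolute value, so the integral in `t` costs at
most `1/n`. -/
theorem lintegral_setLIntegral_curve_le {F G : ℝ → ℝ≥0∞} (hF : Measurable F) (hG : Measurable G)
    {γ γ' : ℝ → ℝ} (hγ : Measurable γ) {S : Set ℝ} (hS : MeasurableSet S)
    (hγ' : ∀ t ∈ S, HasDerivWithinAt γ (γ' t) S t) (hinj : InjOn (fun t => t - γ t) S)
    {n : ℝ} (hn : 0 < n) (hnγ : ∀ t ∈ S, n ≤ |1 - γ' t|) :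
    ∫⁻ x, ∫⁻ t in S, F (x - t) * G (x - γ t) ≤
      ENNReal.ofReal n⁻¹ * ((∫⁻ x, F x) * ∫⁻ x, G x) := by
  rw [lintegral_lintegral_swap (by fun_prop)]
  have h1 : ∀ t, ∫⁻ x, F (x - t) * G (x - γ t) = ∫⁻ y, F y * G (y + (t - γ t)) := by
    intro t
    rw [← lintegral_sub_right_eq_self (fun y => F y * G (y + (t - γ t))) t]
    refine lintegral_congr fun x => ?_
    congr 2; ring
  simp only [h1]
  rw [lintegral_lintegral_swap (by fun_prop)]
  calc ∫⁻ y, ∫⁻ t in S, F y * G (y + (t - γ t))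
      ≤ ∫⁻ y, F y * (ENNReal.ofReal n⁻¹ * ∫⁻ x, G x) := by
        refine lintegral_mono fun y => ?_
        rw [lintegral_const_mul _ (by fun_prop)]
        gcongr
        refine (setLIntegral_comp_le hS (fun t ht => (hasDerivWithinAt_id t S).sub (hγ' t ht))
          hinj hn hnγ (fun z => G (y + z))).trans ?_
        rw [lintegral_add_left_eq_self G y]
    _ = _ := by rw [lintegral_mul_const _ hF]; ring

theorem setLIntegral_Icc_comp_add (F : ℝ → ℝ≥0∞) (c d y : ℝ) :
    ∫⁻ s in Icc c d, F (y + s) = ∫⁻ z in Icc (y + c) (y + d), F z := by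
  rw [← lintegral_indicator measurableSet_Icc, ← lintegral_indicator measurableSet_Icc,
    ← lintegral_add_left_eq_self ((Icc (y + c) (y + d)).indicator F) y]
  refine lintegral_congr fun s => ?_
  simp [indicator_apply]

theorem lintegral_setLIntegral_Icc_comp_add {F : ℝ → ℝ≥0∞} (hF : Measurable F) (c d : ℝ) :
    ∫⁻ y, ∫⁻ s in Icc c d, F (y + s) = ENNReal.ofReal (d - c) * ∫⁻ x, F x := by
  have := lintegral_setLIntegral_comp_sub hF measurable_neg (Icc c d)
  simpa using this

theorem measurable_setLIntegral_Icc_comp_add {F : ℝ → ℝ≥0∞} (hF : Measurable F) (c d : ℝ) :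
    Measurable fun y => ∫⁻ s in Icc c d, F (y + s) := by
  have := measurable_setLIntegral_comp_sub hF measurable_neg (Icc c d)
  simpa using this

/-- The `L¹ × L¹ → L^{1/2}` estimate, by localization at the scale `ℓ` and Cauchy–Schwarz. -/
theorem lintegral_sqrt_setLIntegral_curve_le {F G : ℝ → ℝ≥0∞} (hF : Measurable F)
    (hG : Measurable G) (hF1 : ∫⁻ x, F x ≤ 1) (hG1 : ∫⁻ x, G x ≤ 1)
    {γ γ' : ℝ → ℝ} (hγ : Measurable γ) {S : Set ℝ} (hS : MeasurableSet S)
    (hγ' : ∀ t ∈ S, HasDerivWithinAt γ (γ' t) S t) (hinj : InjOn (fun t => t - γ t) S)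
    {n : ℝ} (hn : 0 < n) (hnγ : ∀ t ∈ S, n ≤ |1 - γ' t|) {ℓ s₀ g₀ : ℝ} (hℓ : 0 < ℓ)
    (hSℓ : ∀ t ∈ S, t ∈ Icc s₀ (s₀ + ℓ)) (hγℓ : ∀ t ∈ S, γ t ∈ Icc g₀ (g₀ + ℓ)) :
    ∫⁻ x, (∫⁻ t in S, F (x - t) * G (x - γ t)) ^ (1 / 2 : ℝ) ≤
      2 * (ENNReal.ofReal ℓ * ENNReal.ofReal n⁻¹) ^ (1 / 2 : ℝ) := by
  set h : ℝ → ℝ≥0∞ := fun x => ∫⁻ t in S, F (x - t) * G (x - γ t) with hh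
  have hhm : Measurable h := measurable_setLIntegral_curve hF hG hγ S
  have hh2 : Measurable fun x => h x ^ (1 / 2 : ℝ) := hhm.pow_const _
  set Fs : ℝ → ℝ≥0∞ := fun y => ∫⁻ s in Icc (-s₀ - ℓ) (-s₀ + ℓ), F (y + s) with hFs
  set Gs : ℝ → ℝ≥0∞ := fun y => ∫⁻ s in Icc (-g₀ - ℓ) (-g₀ + ℓ), G (y + s) with hGs
  set c := ENNReal.ofReal ℓ with hc
  set N := ENNReal.ofReal n⁻¹ with hN
  have hc0 : c ≠ 0 := by simpa [hc] using hℓ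
  have hct : c ≠ ⊤ := ENNReal.ofReal_ne_top
  have hFsm : Measurable Fs := measurable_setLIntegral_Icc_comp_add hF _ _
  have hGsm : Measurable Gs := measurable_setLIntegral_Icc_comp_add hG _ _
  have h2ℓ : ENNReal.ofReal (ℓ + ℓ) = 2 * c := by
    rw [← two_mul, ENNReal.ofReal_mul (by norm_num), ENNReal.ofReal_ofNat]
  have hFsi : ∫⁻ y, Fs y ≤ 2 * c := by
    rw [hFs, lintegral_setLIntegral_Icc_comp_add hF]
    refine (mul_le_mul_right hF1 _).trans (le_of_eq ?_)
    rw [mul_one, ← h2ℓ]; congr 1; ring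
  have hGsi : ∫⁻ y, Gs y ≤ 2 * c := by
    rw [hGs, lintegral_setLIntegral_Icc_comp_add hG]
    refine (mul_le_mul_right hG1 _).trans (le_of_eq ?_)
    rw [mul_one, ← h2ℓ]; congr 1; ring
  -- For `x` in a window of length `ℓ`, both `x - t` and `x - γ(t)` stay in windows of length `2ℓ`,
  -- so the L¹ bound applies to the truncated functions.
  have hloc : ∀ y, ∫⁻ s in Icc 0 ℓ, h (y + s) ≤ N * (Fs y * Gs y) := by
    intro y
    rw [setLIntegral_Icc_comp_add, hFs, hGs]
    simp only [setLIntegral_Icc_comp_add]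
    rw [← lintegral_indicator measurableSet_Icc, ← lintegral_indicator measurableSet_Icc,
      ← lintegral_indicator measurableSet_Icc]
    refine le_trans (lintegral_mono fun x => ?_) (lintegral_setLIntegral_curve_le
      (hF.indicator measurableSet_Icc) (hG.indicator measurableSet_Icc) hγ hS hγ' hinj hn hnγ)
    rw [indicator_apply]
    split_ifs with hx
    · refine setLIntegral_mono' hS fun t ht => ?_
      have h1 := hSℓ t ht
      have h2 := hγℓ t ht
      rw [indicator_of_mem, indicator_of_mem]
      · simp only [mem_Icc] at *; constructor <;> linarith
      · simp only [mem_Icc] at *; constructor <;> linarith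
    · exact zero_le
  have hCS : ∀ y, ∫⁻ s in Icc 0 ℓ, h (y + s) ^ (1 / 2 : ℝ) ≤
      c ^ (1 / 2 : ℝ) * (N * (Fs y * Gs y)) ^ (1 / 2 : ℝ) := by
    intro y
    have := ENNReal.lintegral_mul_norm_pow_le (μ := volume.restrict (Icc 0 ℓ))
      (f := fun _ => 1) (g := fun s => h (y + s)) (by fun_prop)
      (hhm.comp (measurable_const.add measurable_id)).aemeasurable
      (p := 1 / 2) (q := 1 / 2) (by norm_num) (by norm_num) (by norm_num)
    simp only [ENNReal.one_rpow, one_mul, lintegral_const, Measure.restrict_apply_univ,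
      Real.volume_Icc, sub_zero] at this
    refine this.trans ?_
    gcongr
    exact hloc y
  have hFG : ∫⁻ y, Fs y ^ (1 / 2 : ℝ) * Gs y ^ (1 / 2 : ℝ) ≤ 2 * c := by
    refine (ENNReal.lintegral_mul_norm_pow_le hFsm.aemeasurable hGsm.aemeasurable
      (by norm_num) (by norm_num) (by norm_num)).trans ?_
    calc _ ≤ (2 * c) ^ (1 / 2 : ℝ) * (2 * c) ^ (1 / 2 : ℝ) := by gcongr
      _ = 2 * c := by
        rw [← ENNReal.rpow_add_of_nonneg _ _ (by norm_num) (by norm_num)]; norm_num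
  -- Averaging over all windows counts each `x` with weight `ℓ`. Cauchy–Schwarz is used twice,
  -- within each window and then over the windows.
  have hmain : c * ∫⁻ x, h x ^ (1 / 2 : ℝ) ≤ c * (2 * (c * N) ^ (1 / 2 : ℝ)) := by
    calc c * ∫⁻ x, h x ^ (1 / 2 : ℝ)
        = ∫⁻ y, ∫⁻ s in Icc 0 ℓ, h (y + s) ^ (1 / 2 : ℝ) := by
          rw [lintegral_setLIntegral_Icc_comp_add hh2, sub_zero]
      _ ≤ ∫⁻ y, (c * N) ^ (1 / 2 : ℝ) * (Fs y ^ (1 / 2 : ℝ) * Gs y ^ (1 / 2 : ℝ)) := by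
          refine lintegral_mono fun y => (hCS y).trans (le_of_eq ?_)
          simp only [ENNReal.mul_rpow_of_nonneg _ _ (show (0 : ℝ) ≤ 1 / 2 by norm_num)]
          ring
      _ = (c * N) ^ (1 / 2 : ℝ) * ∫⁻ y, Fs y ^ (1 / 2 : ℝ) * Gs y ^ (1 / 2 : ℝ) := by
          rw [lintegral_const_mul _ (by fun_prop)]
      _ ≤ (c * N) ^ (1 / 2 : ℝ) * (2 * c) := by gcongr
      _ = _ := by ring
  exact (ENNReal.mul_le_mul_iff_right hc0 hct).1 hmain

/-! ### Elementary bounds for one piece of the curve -/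

/-- A piece of the curve: the measure `μ` is at most `κ` times Lebesgue measure on `(a, b]`. -/
structure CurvePiece (γ γ' : ℝ → ℝ) (μ : Measure ℝ) (a b κ : ℝ) : Prop where
  lt : a < b
  pos : 0 < κ
  le : μ ≤ ENNReal.ofReal κ • volume.restrict (Ioc a b)
  measurable : Measurable γ
  hasDerivAt : ∀ t ∈ Ioc a b, HasDerivAt γ (γ' t) t

theorem injOn_of_hasDerivAt_ne_zero {φ φ' : ℝ → ℝ} {S : Set ℝ} (hS : S.OrdConnected)
    (h : ∀ t ∈ S, HasDerivAt φ (φ' t) t) (h0 : ∀ t ∈ S, φ' t ≠ 0) : InjOn φ S := by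
  have key : ∀ x ∈ S, ∀ y ∈ S, x < y → φ x ≠ φ y := by
    intro x hx y hy hxy he
    have hsub : Icc x y ⊆ S := hS.out hx hy
    obtain ⟨c, hc, hc0⟩ := exists_hasDerivAt_eq_zero hxy
      (fun t ht => (h t (hsub ht)).continuousAt.continuousWithinAt) he
      (fun t ht => h t (hsub (Ioo_subset_Icc_self ht)))
    exact h0 c (hsub (Ioo_subset_Icc_self hc)) hc0
  intro x hx y hy he
  rcases lt_trichotomy x y with h | h | h
  · exact absurd he (key x hx y hy h)
  · exact h
  · exact absurd he.symm (key y hy x hx h)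

namespace CurvePiece

variable {γ γ' : ℝ → ℝ} {μ : Measure ℝ} {a b κ : ℝ}

theorem curveOp_le (h : CurvePiece γ γ' μ a b κ) (F G : ℝ → ℝ≥0∞) (x : ℝ) :
    curveOp γ μ F G x ≤ ENNReal.ofReal κ * ∫⁻ t in Ioc a b, F (x - t) * G (x - γ t) := by
  refine (lintegral_mono' h.le le_rfl).trans ?_
  rw [lintegral_smul_measure, smul_eq_mul]

theorem boundedAt_zero_zero_zero (h : CurvePiece γ γ' μ a b κ) :
    BoundedAt (curveOp γ μ) (κ * (b - a)) (0, 0, 0) := by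
  intro F G _ _ _ _
  refine ⟨0, measurable_zero, by simp, fun x => (h.curveOp_le _ _ x).trans ?_⟩
  simp [ENNReal.ofReal_mul h.pos.le]

theorem boundedAt_one_zero_zero (h : CurvePiece γ γ' μ a b κ) :
    BoundedAt (curveOp γ μ) κ (1, 0, 0) := by
  intro F G _ _ hF1 _
  refine ⟨0, measurable_zero, by simp, fun x => (h.curveOp_le _ _ x).trans ?_⟩
  simp only [ENNReal.rpow_one, ENNReal.rpow_zero, mul_one]
  calc _ ≤ ENNReal.ofReal κ * ∫⁻ t, F (x - t) := by gcongr; exact Measure.restrict_le_self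
    _ ≤ ENNReal.ofReal κ * 1 := by rw [lintegral_sub_left_eq_self F x]; gcongr
    _ = _ := mul_one _

theorem boundedAt_zero_one_zero (h : CurvePiece γ γ' μ a b κ) {m : ℝ} (hm : 0 < m)
    (hmγ : ∀ t ∈ Ioc a b, m ≤ |γ' t|) :
    BoundedAt (curveOp γ μ) (κ / m) (0, 1, 0) := by
  intro F G _ _ _ hG1
  refine ⟨0, measurable_zero, by simp, fun x => (h.curveOp_le _ _ x).trans ?_⟩
  simp only [ENNReal.rpow_one, ENNReal.rpow_zero, mul_one, one_mul]
  rw [div_eq_mul_inv, ENNReal.ofReal_mul h.pos.le]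
  gcongr
  refine (setLIntegral_comp_le measurableSet_Ioc (fun t ht => (h.hasDerivAt t ht).hasDerivWithinAt)
    (injOn_of_hasDerivAt_ne_zero ordConnected_Ioc h.hasDerivAt fun t ht h0 => ?_) hm hmγ
    (fun z => G (x - z))).trans ?_
  · have := hmγ t ht
    rw [h0, abs_zero] at this
    linarith
  · rw [lintegral_sub_left_eq_self G x]
    exact (mul_le_mul_right hG1 _).trans (by simp)

theorem exists_average (hab : a < b) {F : ℝ → ℝ≥0∞} (hF : Measurable F) (hF1 : ∫⁻ x, F x ≤ 1)
    {φ : ℝ → ℝ} (hφ : Measurable φ) :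
    ∃ M : ℝ → ℝ≥0∞, Measurable M ∧ ∫⁻ x, M x ≤ 1 ∧
      ∀ x, ∫⁻ t in Ioc a b, F (x - φ t) = ENNReal.ofReal (b - a) * M x := by
  have h0 : ENNReal.ofReal (b - a) ≠ 0 := by simpa using hab
  refine ⟨fun x => (ENNReal.ofReal (b - a))⁻¹ * ∫⁻ t in Ioc a b, F (x - φ t),
    (measurable_setLIntegral_comp_sub hF hφ _).const_mul _, ?_, fun x => ?_⟩
  · rw [lintegral_const_mul _ (measurable_setLIntegral_comp_sub hF hφ _),
      lintegral_setLIntegral_comp_sub hF hφ, Real.volume_Ioc, ← mul_assoc,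
      ENNReal.inv_mul_cancel h0 ENNReal.ofReal_ne_top, one_mul]
    exact hF1
  · rw [← mul_assoc, ENNReal.mul_inv_cancel h0 ENNReal.ofReal_ne_top, one_mul]

theorem boundedAt_one_zero_one (h : CurvePiece γ γ' μ a b κ) :
    BoundedAt (curveOp γ μ) (κ * (b - a)) (1, 0, 1) := by
  intro F G hF _ hF1 _
  obtain ⟨M, hM, hM1, hMF⟩ := exists_average h.lt hF hF1 measurable_id
  refine ⟨M, hM, hM1, fun x => (h.curveOp_le _ _ x).trans (le_of_eq ?_)⟩
  simp only [id] at hMF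
  simp only [ENNReal.rpow_one, ENNReal.rpow_zero, mul_one]
  rw [hMF, ENNReal.ofReal_mul h.pos.le, mul_assoc]

theorem boundedAt_zero_one_one (h : CurvePiece γ γ' μ a b κ) :
    BoundedAt (curveOp γ μ) (κ * (b - a)) (0, 1, 1) := by
  intro F G _ hG _ hG1
  obtain ⟨M, hM, hM1, hMG⟩ := exists_average h.lt hG hG1 h.measurable
  refine ⟨M, hM, hM1, fun x => (h.curveOp_le _ _ x).trans (le_of_eq ?_)⟩
  simp only [ENNReal.rpow_one, ENNReal.rpow_zero, one_mul]
  rw [hMG, ENNReal.ofReal_mul h.pos.le, mul_assoc]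

theorem injOn_id_sub (h : CurvePiece γ γ' μ a b κ) {n : ℝ} (hn : 0 < n)
    (hnγ : ∀ t ∈ Ioc a b, n ≤ |1 - γ' t|) : InjOn (fun t => t - γ t) (Ioc a b) := by
  refine injOn_of_hasDerivAt_ne_zero ordConnected_Ioc
    (fun t ht => (hasDerivAt_id t).sub (h.hasDerivAt t ht)) fun t ht h0 => ?_
  have := hnγ t ht
  rw [h0, abs_zero] at this
  linarith

theorem boundedAt_one_one_one (h : CurvePiece γ γ' μ a b κ) {n : ℝ} (hn : 0 < n)
    (hnγ : ∀ t ∈ Ioc a b, n ≤ |1 - γ' t|) :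
    BoundedAt (curveOp γ μ) (κ / n) (1, 1, 1) := by
  intro F G hF hG hF1 hG1
  have hmeas := measurable_setLIntegral_curve hF hG h.measurable (Ioc a b)
  refine ⟨fun x => ENNReal.ofReal n * ∫⁻ t in Ioc a b, F (x - t) * G (x - γ t),
    hmeas.const_mul _, ?_, fun x => (h.curveOp_le _ _ x).trans (le_of_eq ?_)⟩
  · rw [lintegral_const_mul _ hmeas]
    calc _ ≤ ENNReal.ofReal n * (ENNReal.ofReal n⁻¹ * (1 * 1)) := by
          gcongr
          refine (lintegral_setLIntegral_curve_le hF hG h.measurable measurableSet_Ioc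
            (fun t ht => (h.hasDerivAt t ht).hasDerivWithinAt) (h.injOn_id_sub hn hnγ)
            hn hnγ).trans ?_
          gcongr
      _ = 1 := by
          rw [mul_one, mul_one, ← ENNReal.ofReal_mul hn.le, mul_inv_cancel₀ hn.ne',
            ENNReal.ofReal_one]
  · simp only [ENNReal.rpow_one]
    rw [← mul_assoc, ← ENNReal.ofReal_mul (by have := h.pos; positivity),
      div_mul_cancel₀ _ hn.ne']

theorem boundedAt_one_one_two (h : CurvePiece γ γ' μ a b κ) {n : ℝ} (hn : 0 < n)
    (hnγ : ∀ t ∈ Ioc a b, n ≤ |1 - γ' t|) {ℓ g₀ : ℝ} (hℓ : b - a ≤ ℓ)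
    (hγℓ : ∀ t ∈ Ioc a b, γ t ∈ Icc g₀ (g₀ + ℓ)) :
    BoundedAt (curveOp γ μ) (4 * κ * ℓ / n) (1, 1, 2) := by
  intro F G hF hG hF1 hG1
  have hℓ0 : 0 < ℓ := by linarith [h.lt]
  have hκ := h.pos
  have hmeas := measurable_setLIntegral_curve hF hG h.measurable (Ioc a b)
  have hc : 0 < n / (4 * ℓ) := by positivity
  have hhalf : (0 : ℝ) ≤ 1 / 2 := by norm_num
  -- The factor 4 is the square of the 2 in the square-root estimate, so that the majorant has
  -- integral at most one.
  refine ⟨fun x => (ENNReal.ofReal (n / (4 * ℓ)) *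
    ∫⁻ t in Ioc a b, F (x - t) * G (x - γ t)) ^ (1 / 2 : ℝ),
    (hmeas.const_mul _).pow_const _, ?_, fun x => (h.curveOp_le _ _ x).trans (le_of_eq ?_)⟩
  · simp only [ENNReal.mul_rpow_of_nonneg _ _ hhalf]
    rw [lintegral_const_mul _ (hmeas.pow_const _)]
    refine (mul_le_mul_right (lintegral_sqrt_setLIntegral_curve_le hF hG hF1 hG1 h.measurable
      measurableSet_Ioc (fun t ht => (h.hasDerivAt t ht).hasDerivWithinAt)
      (h.injOn_id_sub hn hnγ) hn hnγ hℓ0 (s₀ := a)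
      (fun t ht => ⟨ht.1.le, by linarith [ht.2]⟩) hγℓ) _).trans (le_of_eq ?_)
    have e4 : (2 : ℝ≥0∞) = (ENNReal.ofReal 4) ^ (1 / 2 : ℝ) := by
      rw [show (4 : ℝ) = 2 * 2 by norm_num, ENNReal.ofReal_mul (by norm_num),
        ENNReal.mul_rpow_of_nonneg _ _ hhalf,
        ← ENNReal.rpow_add_of_nonneg _ _ hhalf hhalf]
      norm_num
    rw [e4, ← ENNReal.mul_rpow_of_nonneg _ _ hhalf, ← ENNReal.mul_rpow_of_nonneg _ _ hhalf,
      ← ENNReal.ofReal_mul hℓ0.le, ← ENNReal.ofReal_mul (by norm_num), ← ENNReal.ofReal_mul hc.le,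
      show n / (4 * ℓ) * (4 * (ℓ * n⁻¹)) = 1 by field_simp, ENNReal.ofReal_one, ENNReal.one_rpow]
  · simp only [ENNReal.rpow_one]
    rw [← ENNReal.rpow_mul, show (1 / 2 * 2 : ℝ) = 1 by norm_num, ENNReal.rpow_one, ← mul_assoc,
      ← ENNReal.ofReal_mul (by positivity)]
    congr 2
    field_simp

end CurvePiece

/-! ### Consequences of the curve hypothesis: signs, power bounds, the turning point -/

theorem pos_of_hasDerivAt_pos {φ φ' : ℝ → ℝ} (hφ : ∀ t, 0 < t → HasDerivAt φ (φ' t) t)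
    (h0 : ∀ t, 0 < t → 0 < φ' t) (hlim : Tendsto φ (𝓝[>] 0) (𝓝 0)) :
    StrictMonoOn φ (Ioi 0) ∧ ∀ t, 0 < t → 0 < φ t := by
  have hmono : StrictMonoOn φ (Ioi 0) := by
    refine strictMonoOn_of_deriv_pos (convex_Ioi 0)
      (fun t ht => (hφ t ht).continuousAt.continuousWithinAt) fun t ht => ?_
    rw [interior_Ioi] at ht
    rw [(hφ t ht).deriv]
    exact h0 t ht
  refine ⟨hmono, fun t ht => ?_⟩
  have h1 : 0 ≤ φ (t / 2) := by
    refine le_of_tendsto hlim ?_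
    filter_upwards [Ioo_mem_nhdsGT (half_pos ht)] with s hs
    exact (hmono hs.1 (half_pos ht) hs.2).le
  exact h1.trans_lt (hmono (half_pos ht) ht (half_lt_self ht))

/-- A function on `(0, ∞)` with nowhere vanishing derivative and limit `0` at `0⁺` has a constant
sign and is strictly monotone away from `0`. -/
theorem sign_of_hasDerivAt_ne_zero {φ φ' : ℝ → ℝ} (hφ : ∀ t, 0 < t → HasDerivAt φ (φ' t) t)
    (h0 : ∀ t, 0 < t → φ' t ≠ 0) (hlim : Tendsto φ (𝓝[>] 0) (𝓝 0)) :
    (StrictMonoOn φ (Ioi 0) ∧ ∀ t, 0 < t → 0 < φ t ∧ 0 < φ' t) ∨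
      (StrictAntiOn φ (Ioi 0) ∧ ∀ t, 0 < t → φ t < 0 ∧ φ' t < 0) := by
  rcases hasDerivWithinAt_forall_lt_or_forall_gt_of_forall_ne (convex_Ioi (0 : ℝ))
    (fun t ht => (hφ t ht).hasDerivWithinAt) (m := 0) h0 with h | h
  · right
    obtain ⟨h1, h2⟩ := pos_of_hasDerivAt_pos (φ := fun t => -φ t) (φ' := fun t => -φ' t)
      (fun t ht => (hφ t ht).neg) (fun t ht => by linarith [h t ht]) (by simpa using hlim.neg)
    exact ⟨fun s hs t ht hst => by linarith [h1 hs ht hst],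
      fun t ht => ⟨by linarith [h2 t ht], h t ht⟩⟩
  · left
    obtain ⟨h1, h2⟩ := pos_of_hasDerivAt_pos hφ h hlim
    exact ⟨h1, fun t ht => ⟨h2 t ht, h t ht⟩⟩

theorem abs_le_abs_of_hasDerivAt_ne_zero {φ φ' : ℝ → ℝ}
    (hφ : ∀ t, 0 < t → HasDerivAt φ (φ' t) t)
    (h0 : ∀ t, 0 < t → φ' t ≠ 0) (hlim : Tendsto φ (𝓝[>] 0) (𝓝 0)) {s t : ℝ} (hs : 0 < s)
    (hst : s ≤ t) : |φ s| ≤ |φ t| := by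
  have ht : 0 < t := hs.trans_le hst
  rcases sign_of_hasDerivAt_ne_zero hφ h0 hlim with ⟨h1, h2⟩ | ⟨h1, h2⟩
  · rw [abs_of_pos (h2 s hs).1, abs_of_pos (h2 t ht).1]
    exact h1.monotoneOn hs ht hst
  · rw [abs_of_neg (h2 s hs).1, abs_of_neg (h2 t ht).1]
    exact neg_le_neg (h1.antitoneOn hs ht hst)

namespace CurveHypothesis

variable {γ : ℝ → ℝ}

theorem ne_zero (h : CurveHypothesis γ) {t : ℝ} (ht : 0 < t) : γ t ≠ 0 := by
  obtain ⟨C, hC, hb⟩ := h.lower_first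
  intro h0
  have := hb t ht
  rw [h0, div_zero, abs_zero] at this
  linarith

theorem deriv_ne_zero (h : CurveHypothesis γ) {t : ℝ} (ht : 0 < t) : deriv γ t ≠ 0 := by
  obtain ⟨C, hC, hb⟩ := h.lower_first
  intro h0
  have := hb t ht
  rw [h0, mul_zero, zero_div, abs_zero] at this
  linarith

theorem deriv_deriv_ne_zero (h : CurveHypothesis γ) {t : ℝ} (ht : 0 < t) :
    deriv (deriv γ) t ≠ 0 := by
  obtain ⟨C, hC, hb⟩ := h.lower_second
  intro h0
  have := hb t ht
  rw [h0, mul_zero, zero_div, abs_zero] at this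
  linarith

theorem hasDerivAt (h : CurveHypothesis γ) {t : ℝ} (ht : 0 < t) :
    HasDerivAt γ (deriv γ t) t :=
  ((h.contDiffOn.differentiableOn (by norm_num)).differentiableAt (Ioi_mem_nhds ht)).hasDerivAt

theorem hasDerivAt_deriv (h : CurveHypothesis γ) {t : ℝ} (ht : 0 < t) :
    HasDerivAt (deriv γ) (deriv (deriv γ) t) t := by
  have h2 : ContDiffOn ℝ (1 + 1) γ (Ioi 0) := by
    have := h.contDiffOn
    norm_num
    exact this
  have h1 := ((contDiffOn_succ_iff_deriv_of_isOpen isOpen_Ioi).1 h2).2.2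
  exact ((h1.differentiableOn (by norm_num)).differentiableAt (Ioi_mem_nhds ht)).hasDerivAt

theorem abs_le_abs (h : CurveHypothesis γ) {s t : ℝ} (hs : 0 < s) (hst : s ≤ t) :
    |γ s| ≤ |γ t| :=
  abs_le_abs_of_hasDerivAt_ne_zero (fun _ => h.hasDerivAt) (fun _ => h.deriv_ne_zero)
    h.tendsto_zero hs hst

theorem abs_deriv_le_abs_deriv (h : CurveHypothesis γ) {s t : ℝ} (hs : 0 < s) (hst : s ≤ t) :
    |deriv γ s| ≤ |deriv γ t| :=
  abs_le_abs_of_hasDerivAt_ne_zero (fun _ => h.hasDerivAt_deriv) (fun _ => h.deriv_deriv_ne_zero)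
    h.tendsto_deriv_zero hs hst

theorem exists_mul_abs_le (h : CurveHypothesis γ) :
    ∃ C : ℝ, 0 < C ∧ ∀ t, 0 < t → C * |γ t| ≤ t * |deriv γ t| := by
  obtain ⟨C, hC, hb⟩ := h.lower_first
  refine ⟨C, hC, fun t ht => ?_⟩
  have := hb t ht
  rwa [abs_div, abs_mul, abs_of_pos ht, le_div_iff₀ (abs_pos.2 (h.ne_zero ht))] at this

theorem exists_le_mul_abs (h : CurveHypothesis γ) :
    ∃ C : ℝ, 0 < C ∧ ∀ t, 0 < t → t * |deriv γ t| ≤ C * |γ t| := by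
  obtain ⟨C, hC, hb⟩ := h.upper_first
  refine ⟨C, hC, fun t ht => ?_⟩
  have := hb t ht
  rwa [abs_div, abs_mul, abs_of_pos ht, div_le_iff₀ (abs_pos.2 (h.ne_zero ht))] at this

/-- The upper bound on `|tγ'/γ|` says that `log |γ| - C log t` has nonpositive derivative. Doubling
and boundedness of the logarithmic ratio both follow. -/
theorem exists_log_sub_log_le (h : CurveHypothesis γ) :
    ∃ C : ℝ, 0 < C ∧ ∀ s t, 0 < s → s ≤ t →
      Real.log |γ t| - Real.log |γ s| ≤ C * (Real.log t - Real.log s) := by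
  obtain ⟨C, hC, hb⟩ := h.upper_first
  refine ⟨C, hC, fun s t hs hst => ?_⟩
  have hd : ∀ t ∈ Ioi (0 : ℝ), HasDerivAt (fun t => Real.log (γ t) - C * Real.log t)
      (deriv γ t / γ t - C * t⁻¹) t := fun t ht =>
    ((h.hasDerivAt ht).log (h.ne_zero ht)).sub ((Real.hasDerivAt_log (ne_of_gt ht)).const_mul C)
  have hanti : AntitoneOn (fun t => Real.log (γ t) - C * Real.log t) (Ioi 0) := by
    refine antitoneOn_of_deriv_nonpos (convex_Ioi 0)
      (fun t ht => (hd t ht).continuousAt.continuousWithinAt)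
      (fun t ht => (hd t (interior_subset ht)).differentiableAt.differentiableWithinAt)
      fun t ht => ?_
    have ht : 0 < t := interior_subset ht
    rw [(hd t ht).deriv]
    have h1 := (le_abs_self _).trans (hb t ht)
    have h2 : deriv γ t / γ t = t * deriv γ t / γ t * t⁻¹ := by field_simp
    rw [h2]
    have : t * deriv γ t / γ t * t⁻¹ ≤ C * t⁻¹ := by gcongr
    linarith
  have := hanti (mem_Ioi.2 hs) (mem_Ioi.2 (hs.trans_le hst)) hst
  simp only [Real.log_abs] at *
  linarith

theorem exists_doubling (h : CurveHypothesis γ) :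
    ∃ D : ℝ, 0 < D ∧ ∀ t, 0 < t → |γ (2 * t)| ≤ D * |γ t| := by
  obtain ⟨C, hC, hb⟩ := h.exists_log_sub_log_le
  refine ⟨Real.exp (C * Real.log 2), Real.exp_pos _, fun t ht => ?_⟩
  have h1 := hb t (2 * t) ht (by linarith)
  rw [Real.log_mul two_ne_zero ht.ne', add_sub_cancel_right] at h1
  rw [← Real.exp_log (abs_pos.2 (h.ne_zero ht)), ← Real.exp_add,
    ← Real.log_le_iff_le_exp (abs_pos.2 (h.ne_zero (by linarith)))]
  linarith

theorem exists_abs_log_ratio_le (h : CurveHypothesis γ) :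
    ∃ B : ℝ, ∀ t, 0 < t → 1 ≤ |Real.log t| → |Real.log |γ t| / Real.log t| ≤ B := by
  obtain ⟨C, hC, hb⟩ := h.exists_log_sub_log_le
  refine ⟨C + |(Real.log |γ 1|)|, fun t ht hlog => ?_⟩
  have key : |(Real.log |γ t| - Real.log |γ 1|)| ≤ C * |Real.log t| := by
    rcases le_total 1 t with h1 | h1
    · have a1 := hb 1 t one_pos h1
      have a2 := Real.log_le_log (abs_pos.2 (h.ne_zero one_pos)) (h.abs_le_abs one_pos h1)
      rw [abs_of_nonneg (by linarith), abs_of_nonneg (Real.log_nonneg h1)]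
      simpa using a1
    · have a1 := hb t 1 ht h1
      have a2 := Real.log_le_log (abs_pos.2 (h.ne_zero ht)) (h.abs_le_abs ht h1)
      rw [abs_of_nonpos (by linarith), abs_of_nonpos (Real.log_nonpos ht.le h1)]
      simp only [Real.log_one] at a1
      linarith
  have hpos : 0 < |Real.log t| := by linarith
  rw [abs_div, div_le_iff₀ hpos]
  have h1 : |(Real.log |γ t|)| ≤
      |(Real.log |γ t| - Real.log |γ 1|)| + |(Real.log |γ 1|)| := by
    simpa using abs_add_le (Real.log |γ t| - Real.log |γ 1|) (Real.log |γ 1|)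
  nlinarith [abs_nonneg (Real.log |γ 1|)]

/-- Real-valued lower and upper limits carry information only for bounded functions; this licenses
every later use of the four exponents. -/
theorem isBounded_log_ratio (h : CurveHypothesis γ) {l : Filter ℝ} (hl : ∀ᶠ t in l, 0 < t)
    (hlog : ∀ᶠ t in l, 1 ≤ |Real.log t|) :
    IsBoundedUnder (· ≤ ·) l (fun t => Real.log |γ t| / Real.log t) ∧
      IsBoundedUnder (· ≥ ·) l (fun t => Real.log |γ t| / Real.log t) := by
  obtain ⟨B, hB⟩ := h.exists_abs_log_ratio_le
  constructor
  · refine isBoundedUnder_of_eventually_le (a := B) ?_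
    filter_upwards [hl, hlog] with t h1 h2 using (abs_le.1 (hB t h1 h2)).2
  · refine isBoundedUnder_of_eventually_ge (a := -B) ?_
    filter_upwards [hl, hlog] with t h1 h2 using (abs_le.1 (hB t h1 h2)).1

theorem isBounded_log_ratio_zero (h : CurveHypothesis γ) :
    IsBoundedUnder (· ≤ ·) (𝓝[>] 0) (fun t => Real.log |γ t| / Real.log t) ∧
      IsBoundedUnder (· ≥ ·) (𝓝[>] 0) (fun t => Real.log |γ t| / Real.log t) :=
  h.isBounded_log_ratio self_mem_nhdsWithin
    ((tendsto_abs_atBot_atTop.comp Real.tendsto_log_nhdsGT_zero).eventually_ge_atTop 1)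

theorem isBounded_log_ratio_atTop (h : CurveHypothesis γ) :
    IsBoundedUnder (· ≤ ·) atTop (fun t => Real.log |γ t| / Real.log t) ∧
      IsBoundedUnder (· ≥ ·) atTop (fun t => Real.log |γ t| / Real.log t) :=
  h.isBounded_log_ratio (eventually_gt_atTop 0)
    ((tendsto_abs_atTop_atTop.comp Real.tendsto_log_atTop).eventually_ge_atTop 1)

theorem one_lt_omegaZeroSup (h : CurveHypothesis γ) : 1 < omegaZeroSup γ :=
  h.one_lt_omegaZeroInf.trans_le
    (liminf_le_limsup h.isBounded_log_ratio_zero.1 h.isBounded_log_ratio_zero.2)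

theorem omegaInftyInf_le (h : CurveHypothesis γ) : omegaInftyInf γ ≤ omegaInftySup γ :=
  liminf_le_limsup h.isBounded_log_ratio_atTop.1 h.isBounded_log_ratio_atTop.2

theorem exists_rpow_le_abs_of_le (h : CurveHypothesis γ) {s T : ℝ} (hs : omegaZeroSup γ < s)
    (hT : 0 < T) : ∃ K : ℝ, 0 < K ∧ ∀ t, 0 < t → t ≤ T → K * t ^ s ≤ |γ t| := by
  have hs0 : 0 < s := by linarith [h.one_lt_omegaZeroSup]
  have hev := eventually_lt_of_limsup_lt hs h.isBounded_log_ratio_zero.1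
  have hev1 : ∀ᶠ t : ℝ in 𝓝[>] 0, t ^ s ≤ |γ t| := by
    filter_upwards [hev, Ioo_mem_nhdsGT one_pos] with t ht ht1
    have hl : Real.log t < 0 := Real.log_neg ht1.1 ht1.2
    rw [div_lt_iff_of_neg hl] at ht
    rw [Real.rpow_def_of_pos ht1.1, ← Real.le_log_iff_exp_le (abs_pos.2 (h.ne_zero ht1.1))]
    linarith
  obtain ⟨δ, hδ0, hδ⟩ := (mem_nhdsGT_iff_exists_Ioc_subset).1 hev1
  -- The exponent controls `γ` only on `(0, δ]`; on `[δ, T]` monotonicity of `|γ|` suffices, at the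
  -- cost of a smaller constant.
  replace hδ0 : 0 < δ := hδ0
  have hγδ := abs_pos.2 (h.ne_zero hδ0)
  refine ⟨min 1 (|γ δ| / T ^ s), by positivity, fun t ht htT => ?_⟩
  rcases le_total t δ with h1 | h1
  · calc _ ≤ 1 * t ^ s := by gcongr; exact min_le_left _ _
      _ ≤ |γ t| := by rw [one_mul]; exact hδ ⟨ht, h1⟩
  · calc _ ≤ |γ δ| / T ^ s * T ^ s := by gcongr; exact min_le_right _ _
      _ = |γ δ| := div_mul_cancel₀ _ (by positivity)
      _ ≤ |γ t| := h.abs_le_abs hδ0 h1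

theorem exists_rpow_le_abs_of_ge (h : CurveHypothesis γ) {s T : ℝ} (hs0 : 0 < s)
    (hs : s < omegaInftyInf γ) (hT : 0 < T) :
    ∃ K : ℝ, 0 < K ∧ ∀ t, T ≤ t → K * t ^ s ≤ |γ t| := by
  have hev := eventually_lt_of_lt_liminf hs h.isBounded_log_ratio_atTop.2
  have hev1 : ∀ᶠ t : ℝ in atTop, t ^ s ≤ |γ t| := by
    filter_upwards [hev, eventually_gt_atTop 1] with t ht ht1
    have hl : 0 < Real.log t := Real.log_pos ht1
    have ht0 : 0 < t := by linarith
    rw [lt_div_iff₀ hl] at ht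
    rw [Real.rpow_def_of_pos ht0, ← Real.le_log_iff_exp_le (abs_pos.2 (h.ne_zero ht0))]
    linarith
  obtain ⟨R, hR⟩ := eventually_atTop.1 hev1
  set R' := max R T
  have hR'0 : 0 < R' := hT.trans_le (le_max_right _ _)
  have hγT := abs_pos.2 (h.ne_zero hT)
  refine ⟨min 1 (|γ T| / R' ^ s), by positivity, fun t ht => ?_⟩
  have ht0 : 0 < t := hT.trans_le ht
  rcases le_total R' t with h1 | h1
  · calc _ ≤ 1 * t ^ s := by gcongr; exact min_le_left _ _
      _ ≤ |γ t| := by rw [one_mul]; exact hR t ((le_max_left _ _).trans h1)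
  · calc _ ≤ |γ T| / R' ^ s * R' ^ s := by gcongr; exact min_le_right _ _
      _ = |γ T| := div_mul_cancel₀ _ (by positivity)
      _ ≤ |γ t| := h.abs_le_abs hT ht

/-- Since `|γ'|` is increasing and `|γ|` is comparable to `t|γ'|`, the curve lies below a line near
0; the next lemma is the mirror bound near infinity. They decide which of `t` and `γ(t)` sets the
localization scale. -/
theorem exists_abs_le_mul (h : CurveHypothesis γ) {T : ℝ} (hT : 0 < T) :
    ∃ B : ℝ, 0 < B ∧ ∀ t, 0 < t → t ≤ T → |γ t| ≤ B * t := by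
  obtain ⟨C, hC, hb⟩ := h.exists_mul_abs_le
  have := abs_pos.2 (h.deriv_ne_zero hT)
  refine ⟨|deriv γ T| / C, by positivity, fun t ht htT => ?_⟩
  rw [div_mul_eq_mul_div, le_div_iff₀ hC]
  nlinarith [hb t ht, h.abs_deriv_le_abs_deriv ht htT]

theorem exists_mul_le_abs (h : CurveHypothesis γ) {T : ℝ} (hT : 0 < T) :
    ∃ B : ℝ, 0 < B ∧ ∀ t, T ≤ t → B * t ≤ |γ t| := by
  obtain ⟨C, hC, hb⟩ := h.exists_le_mul_abs
  have := abs_pos.2 (h.deriv_ne_zero hT)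
  refine ⟨|deriv γ T| / C, by positivity, fun t ht => ?_⟩
  rw [div_mul_eq_mul_div, div_le_iff₀ hC]
  nlinarith [hb t (hT.trans_le ht), h.abs_deriv_le_abs_deriv hT ht]

/-- The exponent at infinity exceeds 1, so `|γ|` outgrows some power `t^s` with `s > 1`, and `|γ'|`,
being at least a multiple of `|γ|/t`, is unbounded. -/
theorem exists_one_lt_abs_deriv (h : CurveHypothesis γ) : ∃ t, 0 < t ∧ 1 < |deriv γ t| := by
  obtain ⟨C, hC, hb⟩ := h.exists_mul_abs_le
  obtain ⟨s, hs1, hs⟩ := exists_between (h.one_lt_omegaZeroSup.trans_le h.omegaZeroSup_le)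
  obtain ⟨K, hK, hKb⟩ := h.exists_rpow_le_abs_of_ge (by linarith) hs one_pos
  have hlim := (tendsto_rpow_atTop (show 0 < s - 1 by linarith)).eventually_gt_atTop (1 / (C * K))
  obtain ⟨t, ht, ht1⟩ := (hlim.and (eventually_ge_atTop 1)).exists
  have ht0 : 0 < t := by linarith
  refine ⟨t, ht0, ?_⟩
  have h1 := hb t ht0
  have h2 := hKb t ht1
  rw [div_lt_iff₀ (by positivity)] at ht
  have h3 : t ^ s = t ^ (s - 1) * t := by
    rw [← Real.rpow_add_one ht0.ne']; congr 1; ring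
  rw [h3] at h2
  have h4 : C * (K * (t ^ (s - 1) * t)) ≤ t * |deriv γ t| := le_trans (by gcongr) h1
  have h5 : t ^ (s - 1) * (C * K) ≤ |deriv γ t| := by
    refine le_of_mul_le_mul_left ?_ ht0
    linarith
  linarith

/-- The only possible zero `t₀` of `1 - γ'`, with lower bounds for `|1 - γ'|` near `0`, near `∞` and
near `t₀`. -/
theorem exists_turning_point (h : CurveHypothesis γ) :
    ∃ t₀ c : ℝ, 0 < t₀ ∧ 0 < c ∧ (∀ t, 0 < t → t ≤ t₀ / 2 → c ≤ |1 - deriv γ t|) ∧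
      (∀ t, 2 * t₀ ≤ t → c * |deriv γ t| ≤ |1 - deriv γ t|) ∧
      ∀ t, t₀ / 2 ≤ t → t ≤ 2 * t₀ → c * |t - t₀| ≤ |1 - deriv γ t| := by
  rcases sign_of_hasDerivAt_ne_zero (fun _ => h.hasDerivAt_deriv) (fun _ => h.deriv_deriv_ne_zero)
    h.tendsto_deriv_zero with ⟨hmono, hpos⟩ | ⟨-, hneg⟩
  · obtain ⟨T, hT, hT1⟩ := h.exists_one_lt_abs_deriv
    rw [abs_of_pos (hpos T hT).1] at hT1
    obtain ⟨τ, hτ1, hτ⟩ := ((h.tendsto_deriv_zero.eventually (gt_mem_nhds one_pos)).and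
      (Ioo_mem_nhdsGT hT)).exists
    obtain ⟨t₀, ht₀, he⟩ : ∃ t₀ ∈ Icc τ T, deriv γ t₀ = 1 := by
      have hc : ContinuousOn (deriv γ) (Icc τ T) := fun t ht =>
        (h.hasDerivAt_deriv (hτ.1.trans_le ht.1)).continuousAt.continuousWithinAt
      exact intermediate_value_Icc hτ.2.le hc ⟨hτ1.le, hT1.le⟩
    have ht00 : 0 < t₀ := hτ.1.trans_le ht₀.1
    obtain ⟨C, hC, hb⟩ := h.lower_second
    set c₁ := C * |γ (t₀ / 2)| / (2 * t₀) ^ 2 with hc₁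
    have hc₁0 : 0 < c₁ := by
      have := abs_pos.2 (h.ne_zero (half_pos ht00))
      positivity
    have hdd : ∀ t, t₀ / 2 ≤ t → t ≤ 2 * t₀ → c₁ ≤ deriv (deriv γ) t := by
      intro t h1 h2
      have ht : 0 < t := by linarith
      have h3 := hb t ht
      rw [abs_div, le_div_iff₀ (abs_pos.2 (h.ne_zero ht)), abs_mul, abs_of_pos (hpos t ht).2,
        abs_of_pos (show 0 < t ^ 2 by positivity)] at h3
      rw [hc₁, div_le_iff₀ (by positivity)]
      calc C * |γ (t₀ / 2)| ≤ C * |γ t| :=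
            mul_le_mul_of_nonneg_left (h.abs_le_abs (half_pos ht00) h1) hC.le
        _ ≤ t ^ 2 * deriv (deriv γ) t := h3
        _ ≤ (2 * t₀) ^ 2 * deriv (deriv γ) t := by
            have := (hpos t ht).2
            gcongr
        _ = _ := mul_comm _ _
    -- The lower bound on `γ''` makes the zero of `1 - γ'` simple, which gives linear growth of `|1
    -- - γ'|` away from `t₀`.
    have hslope : ∀ s t, t₀ / 2 ≤ s → s ≤ t → t ≤ 2 * t₀ →
        c₁ * (t - s) ≤ deriv γ t - deriv γ s := by
      intro s t h1 h2 h3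
      refine (convex_Icc (t₀ / 2) (2 * t₀)).mul_sub_le_image_sub_of_le_deriv
        (fun r hr => ?_) (fun r hr => ?_) (fun r hr => ?_) s ⟨h1, h2.trans h3⟩ t
        ⟨h1.trans h2, h3⟩ h2
      · exact (h.hasDerivAt_deriv (by linarith [hr.1])).continuousAt.continuousWithinAt
      · have hr := interior_subset hr
        exact (h.hasDerivAt_deriv
          (by linarith [hr.1])).differentiableAt.differentiableWithinAt
      · have hr := interior_subset hr
        exact hdd r hr.1 hr.2
    have hlt1 : deriv γ (t₀ / 2) < 1 := by
      rw [← he]; exact hmono (half_pos ht00) ht00 (by linarith)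
    have hgt1 : 1 < deriv γ (2 * t₀) := by
      rw [← he]; exact hmono ht00 (mem_Ioi.2 (by linarith)) (by linarith)
    have hc₃ : 0 < 1 - 1 / deriv γ (2 * t₀) := by
      rw [sub_pos, div_lt_one (by linarith)]; exact hgt1
    refine ⟨t₀, min c₁ (min (1 - deriv γ (t₀ / 2)) (1 - 1 / deriv γ (2 * t₀))), ht00,
      lt_min hc₁0 (lt_min (by linarith) hc₃), fun t ht htt => ?_, fun t ht => ?_,
      fun t h1 h2 => ?_⟩
    · refine ((min_le_right _ _).trans (min_le_left _ _)).trans (le_trans ?_ (le_abs_self _))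
      linarith [hmono.monotoneOn ht (half_pos ht00) htt]
    · have ht0 : 0 < t := by linarith
      have hm : deriv γ (2 * t₀) ≤ deriv γ t :=
        hmono.monotoneOn (mem_Ioi.2 (by linarith)) ht0 ht
      have hp := (hpos t ht0).1
      rw [abs_of_pos hp]
      calc _ ≤ (1 - 1 / deriv γ (2 * t₀)) * deriv γ t := by
            gcongr; exact (min_le_right _ _).trans (min_le_right _ _)
        _ ≤ deriv γ t - 1 := by
            have : 1 ≤ 1 / deriv γ (2 * t₀) * deriv γ t := by
              rw [one_div_mul_eq_div, le_div_iff₀ (by linarith)]; linarith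
            linarith
        _ ≤ _ := by rw [abs_sub_comm]; exact le_abs_self _
    · refine (mul_le_mul_of_nonneg_right (min_le_left _ _) (abs_nonneg _)).trans ?_
      rcases le_total t t₀ with h3 | h3
      · have := hslope t t₀ h1 h3 (by linarith)
        rw [abs_of_nonpos (by linarith)]
        refine le_trans ?_ (le_abs_self _)
        linarith
      · have := hslope t₀ t (by linarith) h3 h2
        rw [abs_of_nonneg (by linarith), abs_sub_comm]
        refine le_trans ?_ (le_abs_self _)
        linarith
  -- If `γ'` is negative, `1 - γ'` exceeds both 1 and `|γ'|`, so there is no zero and `t₀ = 1` is an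
  -- arbitrary choice.
  · refine ⟨1, 1, one_pos, one_pos, fun t ht _ => ?_, fun t ht => ?_, fun t h1 h2 => ?_⟩
    · have := (hneg t ht).1
      rw [abs_of_pos (by linarith)]; linarith
    · have := (hneg t (by linarith)).1
      rw [abs_of_pos (show 0 < 1 - deriv γ t by linarith), abs_of_neg this]; linarith
    · have := (hneg t (by linarith)).1
      rw [abs_of_pos (show 0 < 1 - deriv γ t by linarith), one_mul, abs_le]
      constructor <;> linarith

end CurveHypothesis

/-! ### Growth rates near zero, near infinity and near the turning point -/

/-- The measure `t ^ (α - 1) dt`. -/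
def powerMeasure (α : ℝ) : Measure ℝ :=
  volume.withDensity fun t => ENNReal.ofReal (t ^ (α - 1))

theorem growthAt_of_boundedAt {γ : ℝ → ℝ} {μ : ℕ → Measure ℝ} {σ K : ℝ} {Q : ℝ × ℝ × ℝ}
    (hQ : 0 ≤ Q) (hK : 0 < K)
    (h : ∀ k : ℕ, BoundedAt (curveOp γ (μ k)) (K * 2 ^ (σ * k)) Q) : GrowthAt γ μ σ Q := by
  refine ⟨hQ, fun ε hε => ⟨K, hK, fun k => (h k).mono ?_⟩⟩
  gcongr
  · norm_num
  · linarith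

/-- Growth rates of a family of pieces of the curve at the points from which the vertices are
obtained by interpolation. -/
structure BasicGrowth (γ : ℝ → ℝ) (μ : ℕ → Measure ℝ) (s e₁ e₂ e₃ e₄ : ℝ) : Prop where
  zero_zero_zero : GrowthAt γ μ s (0, 0, 0)
  one_zero_one : GrowthAt γ μ s (1, 0, 1)
  zero_one_one : GrowthAt γ μ s (0, 1, 1)
  one_zero_zero : GrowthAt γ μ e₁ (1, 0, 0)
  zero_one_zero : GrowthAt γ μ e₂ (0, 1, 0)
  one_one_one : GrowthAt γ μ e₃ (1, 1, 1)
  one_one_two : GrowthAt γ μ e₄ (1, 1, 2)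

theorem GrowthAt.interpolate_eq {γ : ℝ → ℝ} (hγ : Measurable γ) {μ : ℕ → Measure ℝ} {σ₀ σ₁ : ℝ}
    {Q₀ Q₁ : ℝ × ℝ × ℝ} (h₀ : GrowthAt γ μ σ₀ Q₀) (h₁ : GrowthAt γ μ σ₁ Q₁)
    {a σ : ℝ} {Q : ℝ × ℝ × ℝ} (ha0 : 0 ≤ a) (ha1 : a ≤ 1) (hσ : a * σ₀ + (1 - a) * σ₁ ≤ σ)
    (hQ : a • Q₀ + (1 - a) • Q₁ = Q) : GrowthAt γ μ σ Q :=
  hQ ▸ (GrowthAt.interpolate hγ h₀ h₁ ha0 (sub_nonneg.2 ha1) (by ring)).mono hσ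

namespace BasicGrowth

variable {γ : ℝ → ℝ} {μ : ℕ → Measure ℝ} {s e₁ e₂ e₃ e₄ : ℝ}

theorem growthAt_first (h : BasicGrowth γ μ s e₁ e₂ e₃ e₄) (hγ : Measurable γ) {a : ℝ}
    (ha0 : 0 ≤ a) (ha1 : a ≤ 1) (ha : a * e₁ + (1 - a) * s ≤ 0) :
    GrowthAt γ μ 0 (a, 0, 0) ∧ GrowthAt γ μ 0 (1, 0, 1 - a) :=
  ⟨h.one_zero_zero.interpolate_eq hγ h.zero_zero_zero ha0 ha1 ha (by simp),
    h.one_zero_zero.interpolate_eq hγ h.one_zero_one ha0 ha1 ha (by simp)⟩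

theorem growthAt_second (h : BasicGrowth γ μ s e₁ e₂ e₃ e₄) (hγ : Measurable γ) {c : ℝ}
    (hc0 : 0 ≤ c) (hc1 : c ≤ 1) (hc : c * e₂ + (1 - c) * s ≤ 0) :
    GrowthAt γ μ 0 (0, c, 0) ∧ GrowthAt γ μ 0 (0, 1, 1 - c) :=
  ⟨h.zero_one_zero.interpolate_eq hγ h.zero_zero_zero hc0 hc1 hc (by simp),
    h.zero_one_zero.interpolate_eq hγ h.zero_one_one hc0 hc1 hc (by simp)⟩

/-- E and F are reached in two steps: from (1,1,1) and (1,1,2) to (1,1,3 - 1/v), then with weight `1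
- v` towards (1,0,1) or (0,1,1). The total weights are `1 - v`, `2v - 1` and `1 - v`, hence the need
for `v ≥ 1/2`. -/
theorem growthAt_third (h : BasicGrowth γ μ s e₁ e₂ e₃ e₄) (hγ : Measurable γ) {v : ℝ}
    (hv0 : 1 / 2 ≤ v) (hv1 : v ≤ 1) (hv : (1 - v) * e₃ + (2 * v - 1) * e₄ + (1 - v) * s ≤ 0) :
    GrowthAt γ μ 0 (1, v, 2 * v) ∧ GrowthAt γ μ 0 (v, 1, 2 * v) := by
  have hvp : 0 < v := by linarith
  have hR : GrowthAt γ μ (((1 - v) * e₃ + (2 * v - 1) * e₄) / v) (1, 1, 3 - 1 / v) := by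
    refine h.one_one_one.interpolate_eq hγ h.one_one_two (a := (1 - v) / v)
      (div_nonneg (by linarith) hvp.le) ((div_le_one hvp).2 (by linarith)) (le_of_eq ?_) ?_
    · field_simp; ring
    · simp only [Prod.smul_mk, Prod.mk_add_mk, smul_eq_mul, Prod.mk.injEq]
      refine ⟨?_, ?_, ?_⟩ <;> field_simp <;> ring
  have hle : v * (((1 - v) * e₃ + (2 * v - 1) * e₄) / v) + (1 - v) * s ≤ 0 := by
    rwa [mul_div_cancel₀ _ hvp.ne']
  refine ⟨hR.interpolate_eq hγ h.one_zero_one hvp.le hv1 hle ?_,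
    hR.interpolate_eq hγ h.zero_one_one hvp.le hv1 hle ?_⟩ <;>
  · simp only [Prod.smul_mk, Prod.mk_add_mk, smul_eq_mul, Prod.mk.injEq]
    refine ⟨?_, ?_, ?_⟩ <;> field_simp <;> ring

end BasicGrowth

theorem zero_le_triple {u v w : ℝ} (hu : 0 ≤ u) (hv : 0 ≤ v) (hw : 0 ≤ w) :
    (0 : ℝ × ℝ × ℝ) ≤ (u, v, w) := ⟨hu, hv, hw⟩

namespace CurveHypothesis

variable {γ : ℝ → ℝ}

/-- Nothing is known about `γ` off `(0, ∞)`; cutting it off there gives a globally measurable curve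
with the same operator. -/
theorem measurable_indicator (h : CurveHypothesis γ) : Measurable ((Ioi 0).indicator γ) := by
  have hc : ContinuousOn γ (Ioi 0) := h.contDiffOn.continuousOn
  classical
  rw [← piecewise_eq_indicator]
  exact hc.measurable_piecewise continuousOn_const measurableSet_Ioi

theorem hasDerivAt_indicator (h : CurveHypothesis γ) {t : ℝ} (ht : 0 < t) :
    HasDerivAt ((Ioi 0).indicator γ) (deriv γ t) t := by
  refine (h.hasDerivAt ht).congr_of_eventuallyEq ?_
  filter_upwards [Ioi_mem_nhds ht] with s hs
  exact indicator_of_mem hs γ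

theorem curvePiece (h : CurveHypothesis γ) {α a b κ : ℝ} (hα : α ≤ 1) (ha : 0 < a) (hab : a < b)
    (hκ : a ^ (α - 1) ≤ κ) :
    CurvePiece ((Ioi 0).indicator γ) (deriv γ) ((powerMeasure α).restrict (Ioc a b)) a b κ where
  lt := hab
  pos := (Real.rpow_pos_of_pos ha _).trans_le hκ
  le := by
    rw [powerMeasure, restrict_withDensity measurableSet_Ioc, ← withDensity_const]
    refine withDensity_mono ?_
    filter_upwards [ae_restrict_mem measurableSet_Ioc] with t ht
    refine ENNReal.ofReal_le_ofReal (le_trans ?_ hκ)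
    exact Real.rpow_le_rpow_of_nonpos ha ht.1.le (by linarith)
  measurable := h.measurable_indicator
  hasDerivAt := fun t ht => h.hasDerivAt_indicator (ha.trans ht.1)

theorem exists_le_abs_deriv (h : CurveHypothesis γ) :
    ∃ C : ℝ, 0 < C ∧ ∀ a t, 0 < a → t ∈ Ioc a (2 * a) → C * |γ a| / a ≤ |deriv γ t| := by
  obtain ⟨C, hC, hb⟩ := h.exists_mul_abs_le
  refine ⟨C / 2, by positivity, fun a t ha ht => ?_⟩
  have ht0 : 0 < t := ha.trans ht.1
  have h1 := hb t ht0
  have h2 := mul_le_mul_of_nonneg_left (h.abs_le_abs ha ht.1.le) hC.le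
  have h3 : t * |deriv γ t| ≤ 2 * a * |deriv γ t| :=
    mul_le_mul_of_nonneg_right ht.2 (abs_nonneg _)
  rw [div_le_iff₀ ha]
  linarith

/-- On a piece at scale `a = T 2^(-k)` the weight is at most `a^(α-1)`, the length is `a`, `|γ'|` is
at least a multiple of `|γ(a)|/a`, and `|1 - γ'|` is bounded below. Only the rate at (0,1,0)
involves the exponent of `γ`, and only there is an `ε` lost. -/
theorem basicGrowth_small (h : CurveHypothesis γ) {α T c : ℝ} (hα1 : α ≤ 1)
    (hT : 0 < T) (hc : 0 < c) (hn : ∀ t, 0 < t → t ≤ 2 * T → c ≤ |1 - deriv γ t|) :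
    BasicGrowth ((Ioi 0).indicator γ)
      (fun k : ℕ => (powerMeasure α).restrict
        (Ioc (T * 2 ^ (-(k : ℝ))) (2 * (T * 2 ^ (-(k : ℝ))))))
      (-α) (1 - α) (omegaZeroSup γ - α) (1 - α) (-α) := by
  obtain ⟨C, hC, hCb⟩ := h.exists_le_abs_deriv
  obtain ⟨B, hB, hBb⟩ := h.exists_abs_le_mul (T := 2 * T) (by linarith)
  set a : ℕ → ℝ := fun k => T * 2 ^ (-(k : ℝ)) with ha
  have ha0 : ∀ k, 0 < a k := fun k => by positivity
  have haT : ∀ k, a k ≤ T := fun k => by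
    have : (2 : ℝ) ^ (-(k : ℝ)) ≤ 1 :=
      Real.rpow_le_one_of_one_le_of_nonpos (by norm_num) (by simp)
    exact mul_le_of_le_one_right hT.le this
  have hpow : ∀ (s : ℝ) (k : ℕ), a k ^ s = T ^ s * 2 ^ (-s * k) := fun s k => by
    rw [ha, Real.mul_rpow hT.le (by positivity), ← Real.rpow_mul (by norm_num)]
    congr 2; ring
  have hP : ∀ k, CurvePiece ((Ioi 0).indicator γ) (deriv γ)
      ((powerMeasure α).restrict (Ioc (a k) (2 * a k))) (a k) (2 * a k) (a k ^ (α - 1)) :=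
    fun k => h.curvePiece hα1 (ha0 k) (by linarith [ha0 k]) le_rfl
  have hmul : ∀ k, a k ^ (α - 1) * a k = a k ^ α := fun k => by
    rw [← Real.rpow_add_one (ha0 k).ne']; congr 1; ring
  have hlen : ∀ k, a k ^ (α - 1) * (2 * a k - a k) = T ^ α * 2 ^ (-α * k) := fun k => by
    rw [← hpow, ← hmul]; ring
  have hκ : ∀ k, a k ^ (α - 1) = T ^ (α - 1) * 2 ^ ((1 - α) * k) := fun k => by
    rw [hpow]; congr 2; ring
  have hnk : ∀ k, ∀ t ∈ Ioc (a k) (2 * a k), c ≤ |1 - deriv γ t| := fun k t ht =>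
    hn t ((ha0 k).trans ht.1) (ht.2.trans (by linarith [haT k]))
  refine ⟨?_, ?_, ?_, ?_, ?_, ?_, ?_⟩
  · refine growthAt_of_boundedAt le_rfl (K := T ^ α) (by positivity) fun k => ?_
    rw [← hlen]
    exact (hP k).boundedAt_zero_zero_zero
  · refine growthAt_of_boundedAt (zero_le_triple (by simp) (by simp) (by simp))
      (K := T ^ α) (by positivity) fun k => ?_
    rw [← hlen]
    exact (hP k).boundedAt_one_zero_one
  · refine growthAt_of_boundedAt (zero_le_triple (by simp) (by simp) (by simp))
      (K := T ^ α) (by positivity) fun k => ?_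
    rw [← hlen]
    exact (hP k).boundedAt_zero_one_one
  · refine growthAt_of_boundedAt (zero_le_triple (by simp) (by simp) (by simp))
      (K := T ^ (α - 1)) (by positivity) fun k => ?_
    rw [← hκ]
    exact (hP k).boundedAt_one_zero_zero
  · refine ⟨zero_le_triple (by simp) (by simp) (by simp), fun ε hε => ?_⟩
    obtain ⟨K, hK, hKb⟩ := h.exists_rpow_le_abs_of_le
      (show omegaZeroSup γ < omegaZeroSup γ + ε by linarith) hT
    set s := omegaZeroSup γ + ε with hs
    refine ⟨T ^ (α - s) / (C * K), by positivity, fun k => ?_⟩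
    have hγ0 := abs_pos.2 (h.ne_zero (ha0 k))
    have hak := ha0 k
    refine ((hP k).boundedAt_zero_one_zero (m := C * |γ (a k)| / a k) (by positivity)
      fun t ht => hCb (a k) t (ha0 k) ht).mono ?_
    calc a k ^ (α - 1) / (C * |γ (a k)| / a k)
        = a k ^ α / (C * |γ (a k)|) := by rw [← hmul]; field_simp
      _ ≤ a k ^ α / (C * (K * a k ^ s)) := by
          have := hKb (a k) (ha0 k) (haT k)
          gcongr
      _ = a k ^ (α - s) / (C * K) := by rw [Real.rpow_sub hak]; field_simp
      _ = _ := by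
          rw [hpow, show omegaZeroSup γ - α + ε = -(α - s) by rw [hs]; ring]; ring
  · refine growthAt_of_boundedAt (zero_le_triple (by simp) (by simp) (by simp))
      (K := T ^ (α - 1) / c) (by positivity) fun k => ?_
    rw [div_mul_eq_mul_div, ← hκ]
    exact (hP k).boundedAt_one_one_one hc (hnk k)
  · refine growthAt_of_boundedAt (zero_le_triple (by simp) (by simp) (by simp))
      (K := 4 * (4 * B + 1) / c * T ^ α) (by positivity) fun k => ?_
    have hak := ha0 k
    -- On the piece `|γ| ≤ 2B a`, an interval of length `4B a`; the extra `a` covers the length of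
    -- the piece itself.
    refine ((hP k).boundedAt_one_one_two hc (hnk k) (ℓ := (4 * B + 1) * a k)
      (g₀ := -(2 * B * a k)) (by nlinarith) fun t ht => ?_).mono (le_of_eq ?_)
    · have ht0 : 0 < t := hak.trans ht.1
      rw [indicator_of_mem (mem_Ioi.2 ht0)]
      have h1 := abs_le.1 (hBb t ht0 (ht.2.trans (by linarith [haT k])))
      have h2 : B * t ≤ 2 * B * a k := by nlinarith [ht.2]
      constructor <;> linarith
    · rw [mul_assoc (4 * (4 * B + 1) / c), ← hpow, ← hmul]; field_simp

/-- Here `|1 - γ'|` is comparable from below to `|γ'|`, hence to `|γ(a)|/a`, so (1,1,1) has the same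
rate as (0,1,0). -/
theorem basicGrowth_large (h : CurveHypothesis γ) {α T c : ℝ} (hα1 : α ≤ 1)
    (hT : 0 < T) (hc : 0 < c) (hn : ∀ t, T ≤ t → c * |deriv γ t| ≤ |1 - deriv γ t|) :
    BasicGrowth ((Ioi 0).indicator γ)
      (fun k : ℕ => (powerMeasure α).restrict
        (Ioc (T * 2 ^ (k : ℝ)) (2 * (T * 2 ^ (k : ℝ)))))
      α (α - 1) (α - omegaInftyInf γ) (α - omegaInftyInf γ) α := by
  obtain ⟨C, hC, hCb⟩ := h.exists_le_abs_deriv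
  obtain ⟨B, hB, hBb⟩ := h.exists_mul_le_abs hT
  obtain ⟨D, hD, hDb⟩ := h.exists_doubling
  set a : ℕ → ℝ := fun k => T * 2 ^ (k : ℝ) with ha
  have ha0 : ∀ k, 0 < a k := fun k => by positivity
  have haT : ∀ k, T ≤ a k := fun k => by
    have : (1 : ℝ) ≤ (2 : ℝ) ^ (k : ℝ) := Real.one_le_rpow (by norm_num) (by simp)
    exact le_mul_of_one_le_right hT.le this
  have hpow : ∀ (s : ℝ) (k : ℕ), a k ^ s = T ^ s * 2 ^ (s * k) := fun s k => by
    rw [ha, Real.mul_rpow hT.le (by positivity), ← Real.rpow_mul (by norm_num)]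
    congr 2; ring
  have hP : ∀ k, CurvePiece ((Ioi 0).indicator γ) (deriv γ)
      ((powerMeasure α).restrict (Ioc (a k) (2 * a k))) (a k) (2 * a k) (a k ^ (α - 1)) :=
    fun k => h.curvePiece hα1 (ha0 k) (by linarith [ha0 k]) le_rfl
  have hmul : ∀ k, a k ^ (α - 1) * a k = a k ^ α := fun k => by
    rw [← Real.rpow_add_one (ha0 k).ne']; congr 1; ring
  have hlen : ∀ k, a k ^ (α - 1) * (2 * a k - a k) = T ^ α * 2 ^ (α * k) := fun k => by
    rw [← hpow, ← hmul]; ring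
  have hγ0 : ∀ k, 0 < |γ (a k)| := fun k => abs_pos.2 (h.ne_zero (ha0 k))
  have hn0 : ∀ k, 0 < C * |γ (a k)| / a k := fun k => by
    have := ha0 k
    have := hγ0 k
    positivity
  have hnk : ∀ k, ∀ t ∈ Ioc (a k) (2 * a k), c * (C * |γ (a k)| / a k) ≤ |1 - deriv γ t| :=
    fun k t ht => (mul_le_mul_of_nonneg_left (hCb (a k) t (ha0 k) ht) hc.le).trans
      (hn t ((haT k).trans ht.1.le))
  have hsharp : ∀ ε : ℝ, 0 < ε → ∃ K : ℝ, 0 < K ∧ ∀ k : ℕ,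
      a k ^ (α - 1) / (C * |γ (a k)| / a k) ≤ K * 2 ^ ((α - omegaInftyInf γ + ε) * k) := by
    intro ε hε
    have hω : 0 < omegaInftyInf γ := by linarith [h.one_lt_omegaZeroSup, h.omegaZeroSup_le]
    -- The second entry keeps the exponent positive when `ε` is large.
    set s := max (omegaInftyInf γ - ε) (omegaInftyInf γ / 2) with hs
    have hs0 : 0 < s := (half_pos hω).trans_le (le_max_right _ _)
    obtain ⟨K, hK, hKb⟩ := h.exists_rpow_le_abs_of_ge hs0
      (max_lt (by linarith) (by linarith)) hT
    refine ⟨T ^ (α - s) / (C * K), by positivity, fun k => ?_⟩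
    have hak := ha0 k
    have hγk := hγ0 k
    calc a k ^ (α - 1) / (C * |γ (a k)| / a k)
        = a k ^ α / (C * |γ (a k)|) := by rw [← hmul]; field_simp
      _ ≤ a k ^ α / (C * (K * a k ^ s)) := by
          have := hKb (a k) (haT k)
          gcongr
      _ = a k ^ (α - s) / (C * K) := by rw [Real.rpow_sub hak]; field_simp
      _ = T ^ (α - s) / (C * K) * 2 ^ ((α - s) * k) := by rw [hpow]; ring
      _ ≤ _ := by
          gcongr
          · norm_num
          · have := le_max_left (omegaInftyInf γ - ε) (omegaInftyInf γ / 2)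
            linarith
  refine ⟨?_, ?_, ?_, ?_, ?_, ?_, ?_⟩
  · refine growthAt_of_boundedAt le_rfl (K := T ^ α) (by positivity) fun k => ?_
    rw [← hlen]
    exact (hP k).boundedAt_zero_zero_zero
  · refine growthAt_of_boundedAt (zero_le_triple (by simp) (by simp) (by simp))
      (K := T ^ α) (by positivity) fun k => ?_
    rw [← hlen]
    exact (hP k).boundedAt_one_zero_one
  · refine growthAt_of_boundedAt (zero_le_triple (by simp) (by simp) (by simp))
      (K := T ^ α) (by positivity) fun k => ?_
    rw [← hlen]
    exact (hP k).boundedAt_zero_one_one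
  · refine growthAt_of_boundedAt (zero_le_triple (by simp) (by simp) (by simp))
      (K := T ^ (α - 1)) (by positivity) fun k => ?_
    rw [← hpow]
    exact (hP k).boundedAt_one_zero_zero
  · refine ⟨zero_le_triple (by simp) (by simp) (by simp), fun ε hε => ?_⟩
    obtain ⟨K, hK, hKb⟩ := hsharp ε hε
    exact ⟨K, hK, fun k => ((hP k).boundedAt_zero_one_zero (hn0 k)
      fun t ht => hCb (a k) t (ha0 k) ht).mono (hKb k)⟩
  · refine ⟨zero_le_triple (by simp) (by simp) (by simp), fun ε hε => ?_⟩
    obtain ⟨K, hK, hKb⟩ := hsharp ε hε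
    refine ⟨K / c, by positivity, fun k => ((hP k).boundedAt_one_one_one
      (mul_pos hc (hn0 k)) (hnk k)).mono ?_⟩
    rw [mul_comm c, ← div_div, div_mul_eq_mul_div]
    gcongr
    exact hKb k
  · refine growthAt_of_boundedAt (zero_le_triple (by simp) (by simp) (by simp))
      (K := 4 * (2 * D + 1 / B) / (c * C) * T ^ α) (by positivity) fun k => ?_
    have hak := ha0 k
    have hγk := hγ0 k
    have hBk : a k ≤ 1 / B * |γ (a k)| := by
      rw [one_div_mul_eq_div, le_div_iff₀ hB]
      linarith [hBb (a k) (haT k)]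
    -- Now `γ` sets the scale: `ℓ` is a multiple of `|γ(a)|`, which cancels against `n`, a multiple
    -- of `|γ(a)|/a`. The rate is therefore exactly `α`.
    refine ((hP k).boundedAt_one_one_two (mul_pos hc (hn0 k)) (hnk k)
      (ℓ := (2 * D + 1 / B) * |γ (a k)|)
      (g₀ := -(D * |γ (a k)|)) (by nlinarith) fun t ht => ?_).mono (le_of_eq ?_)
    · have ht0 : 0 < t := hak.trans ht.1
      rw [indicator_of_mem (mem_Ioi.2 ht0)]
      have h1 := abs_le.1 ((h.abs_le_abs ht0 ht.2).trans (hDb (a k) hak))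
      constructor <;> nlinarith
    · rw [mul_assoc (4 * (2 * D + 1 / B) / (c * C)), ← hpow, ← hmul]; field_simp

/-- Each interval is no longer than its distance to `t₀`, so `|1 - γ'|` is at least `c` times its
length. At (1,1,1) this costs the inverse length; at (1,1,2) the scale `ℓ`, also a multiple of the
length because `γ` is Lipschitz there, compensates it. -/
theorem basicGrowth_middle (h : CurveHypothesis γ) {α t₀ c T : ℝ} (hα1 : α ≤ 1)
    (ht₀ : 0 < t₀) (hc : 0 < c) (hT : 0 < T)
    (hn : ∀ t, t₀ / 2 ≤ t → t ≤ 2 * t₀ → c * |t - t₀| ≤ |1 - deriv γ t|) {a b : ℕ → ℝ}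
    (ha : ∀ k, t₀ / 2 ≤ a k) (hb : ∀ k, b k ≤ 2 * t₀)
    (hab : ∀ k : ℕ, b k - a k = T * 2 ^ (-(k : ℝ)))
    (hdist : ∀ k, ∀ t ∈ Ioc (a k) (b k), b k - a k ≤ |t - t₀|) :
    BasicGrowth ((Ioi 0).indicator γ)
      (fun k : ℕ => (powerMeasure α).restrict (Ioc (a k) (b k))) (-1) 0 0 1 0 := by
  set κ := (t₀ / 2) ^ (α - 1) with hκ
  have hκ0 : 0 < κ := by positivity
  have hd0 : ∀ k, 0 < b k - a k := fun k => by rw [hab]; positivity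
  have ha0 : ∀ k, 0 < a k := fun k => (half_pos ht₀).trans_le (ha k)
  have hP : ∀ k, CurvePiece ((Ioi 0).indicator γ) (deriv γ)
      ((powerMeasure α).restrict (Ioc (a k) (b k))) (a k) (b k) κ :=
    fun k => h.curvePiece hα1 (ha0 k) (by linarith [hd0 k])
      (Real.rpow_le_rpow_of_nonpos (half_pos ht₀) (ha k) (by linarith))
  have hlen : ∀ k : ℕ, κ * (b k - a k) = κ * T * 2 ^ ((-1 : ℝ) * k) := fun k => by
    rw [hab, mul_assoc, neg_one_mul]
  have hnk : ∀ k, ∀ t ∈ Ioc (a k) (b k), c * (b k - a k) ≤ |1 - deriv γ t| := fun k t ht =>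
    (mul_le_mul_of_nonneg_left (hdist k t ht) hc.le).trans
      (hn t ((ha k).trans ht.1.le) (ht.2.trans (hb k)))
  have hm0 : 0 < |deriv γ (t₀ / 2)| := abs_pos.2 (h.deriv_ne_zero (half_pos ht₀))
  refine ⟨?_, ?_, ?_, ?_, ?_, ?_, ?_⟩
  · refine growthAt_of_boundedAt le_rfl (K := κ * T) (by positivity) fun k => ?_
    rw [← hlen]
    exact (hP k).boundedAt_zero_zero_zero
  · refine growthAt_of_boundedAt (zero_le_triple (by simp) (by simp) (by simp))
      (K := κ * T) (by positivity) fun k => ?_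
    rw [← hlen]
    exact (hP k).boundedAt_one_zero_one
  · refine growthAt_of_boundedAt (zero_le_triple (by simp) (by simp) (by simp))
      (K := κ * T) (by positivity) fun k => ?_
    rw [← hlen]
    exact (hP k).boundedAt_zero_one_one
  · refine growthAt_of_boundedAt (zero_le_triple (by simp) (by simp) (by simp))
      (K := κ) (by positivity) fun k => ?_
    simpa using (hP k).boundedAt_one_zero_zero
  · refine growthAt_of_boundedAt (zero_le_triple (by simp) (by simp) (by simp))
      (K := κ / |deriv γ (t₀ / 2)|) (by positivity) fun k => ?_
    simpa using (hP k).boundedAt_zero_one_zero hm0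
      fun t ht => h.abs_deriv_le_abs_deriv (half_pos ht₀) ((ha k).trans ht.1.le)
  · refine growthAt_of_boundedAt (zero_le_triple (by simp) (by simp) (by simp))
      (K := κ / (c * T)) (by positivity) fun k => ?_
    refine ((hP k).boundedAt_one_one_one (mul_pos hc (hd0 k)) (hnk k)).mono (le_of_eq ?_)
    rw [hab, one_mul, Real.rpow_neg (by norm_num)]
    field_simp
  · set D := |deriv γ (2 * t₀)|
    refine growthAt_of_boundedAt (zero_le_triple (by simp) (by simp) (by simp))
      (K := 4 * κ * (2 * D + 1) / c) (by positivity) fun k => ?_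
    have hdk := hd0 k
    have hDk : 0 ≤ D * (b k - a k) := by positivity
    refine ((hP k).boundedAt_one_one_two (mul_pos hc hdk) (hnk k)
      (ℓ := (2 * D + 1) * (b k - a k)) (g₀ := γ (a k) - D * (b k - a k)) (by linarith)
      fun t ht => ?_).mono (le_of_eq ?_)
    · have ht0 : 0 < t := (ha0 k).trans ht.1
      rw [indicator_of_mem (mem_Ioi.2 ht0)]
      have h1 : ‖γ t - γ (a k)‖ ≤ D * ‖t - a k‖ := by
        refine (convex_Icc (a k) (b k)).norm_image_sub_le_of_norm_hasDerivWithin_le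
          (fun r hr => (h.hasDerivAt ((ha0 k).trans_le hr.1)).hasDerivWithinAt)
          (fun r hr => ?_) ⟨le_rfl, by linarith⟩ ⟨ht.1.le, ht.2⟩
        exact h.abs_deriv_le_abs_deriv ((ha0 k).trans_le hr.1) (hr.2.trans (hb k))
      rw [Real.norm_eq_abs, Real.norm_eq_abs, abs_of_pos (sub_pos.2 ht.1)] at h1
      have h2 : D * (t - a k) ≤ D * (b k - a k) := by
        gcongr
        exact ht.2
      have h3 := abs_le.1 (h1.trans h2)
      constructor <;> linarith
    · simp only [zero_mul, Real.rpow_zero, mul_one]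
      field_simp

end CurveHypothesis

/-! ### Dyadic covering, the conditions on α, and summation of the pieces -/

theorem two_rpow_neg_natCast (k : ℕ) : (2 : ℝ) ^ (-(k : ℝ)) = (1 / 2) ^ k := by
  rw [Real.rpow_neg (by norm_num), Real.rpow_natCast, one_div, inv_pow]

theorem exists_mem_Ioc_half_pow {x T : ℝ} (hx : 0 < x) (hxT : x ≤ 2 * T) :
    ∃ k : ℕ, x ∈ Ioc (T * 2 ^ (-(k : ℝ))) (2 * (T * 2 ^ (-(k : ℝ)))) := by
  have hT : 0 < 2 * T := hx.trans_le hxT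
  obtain ⟨k, hk1, hk2⟩ := exists_nat_pow_near_of_lt_one (x := x / (2 * T)) (y := 1 / 2)
    (by positivity) ((div_le_one hT).2 hxT) (by norm_num) (by norm_num)
  refine ⟨k, ?_, ?_⟩ <;> rw [two_rpow_neg_natCast]
  · rw [lt_div_iff₀ hT, pow_succ] at hk1
    linarith
  · rw [div_le_iff₀ hT] at hk2
    linarith

theorem exists_mem_Ico_half_pow {x T : ℝ} (hx : 0 < x) (hxT : x < 2 * T) :
    ∃ k : ℕ, x ∈ Ico (T * 2 ^ (-(k : ℝ))) (2 * (T * 2 ^ (-(k : ℝ)))) := by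
  have hT : 0 < 2 * T := hx.trans hxT
  obtain ⟨k, hk1, hk2⟩ := exists_nat_pow_near (x := 2 * T / x) (y := 2)
    ((one_le_div hx).2 hxT.le) (by norm_num)
  -- The power selected has its half-open end on the wrong side; when `2^k = 2T/x` the index drops
  -- by one.
  rcases hk1.eq_or_lt with he | hlt
  · have hk0 : k ≠ 0 := by
      rintro rfl
      rw [pow_zero, eq_div_iff hx.ne'] at he
      linarith
    obtain ⟨j, rfl⟩ := Nat.exists_eq_succ_of_ne_zero hk0
    refine ⟨j, ?_⟩
    rw [two_rpow_neg_natCast, one_div, inv_pow]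
    have h2 : (0 : ℝ) < 2 ^ j := by positivity
    have he' : x * 2 ^ j = T := by
      rw [eq_div_iff hx.ne', Nat.succ_eq_add_one, pow_succ] at he
      linarith
    rw [← he', mul_assoc, mul_inv_cancel₀ h2.ne']
    constructor <;> linarith
  · refine ⟨k, ?_⟩
    rw [two_rpow_neg_natCast, one_div, inv_pow]
    have h2 : (0 : ℝ) < 2 ^ k := by positivity
    rw [lt_div_iff₀ hx] at hlt
    rw [div_lt_iff₀ hx, pow_succ] at hk2
    constructor
    · rw [← div_eq_mul_inv, div_le_iff₀ h2]
      linarith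
    · rw [← div_eq_mul_inv, ← mul_div_assoc, lt_div_iff₀ h2]
      linarith

theorem exists_mem_Ioc_two_pow {x T : ℝ} (hT : 0 < T) (hxT : T < x) :
    ∃ k : ℕ, x ∈ Ioc (T * 2 ^ (k : ℝ)) (2 * (T * 2 ^ (k : ℝ))) := by
  have hx : 0 < x := hT.trans hxT
  -- The inversion `x ↦ T²/x` exchanges large and small scales, and with them the two kinds of
  -- half-open interval.
  obtain ⟨k, hk1, hk2⟩ := exists_mem_Ico_half_pow (x := T ^ 2 / x) (T := T / 2) (by positivity)
    (by rw [div_lt_iff₀ hx]; nlinarith)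
  have h2 : (0 : ℝ) < 2 ^ (k : ℝ) := by positivity
  rw [Real.rpow_neg (by norm_num), ← div_eq_mul_inv] at hk1 hk2
  refine ⟨k, ?_, ?_⟩
  · rw [← mul_div_assoc, mul_div_cancel₀ _ (by norm_num), div_lt_div_iff₀ hx h2, sq, mul_assoc]
      at hk2
    exact lt_of_mul_lt_mul_left hk2 hT.le
  · rw [div_le_div_iff₀ h2 hx, sq, div_mul_eq_mul_div, div_le_iff₀ (by norm_num)] at hk1
    refine le_of_mul_le_mul_left ?_ hT
    linarith

theorem powerMeasure_singleton (α t : ℝ) : powerMeasure α {t} = 0 :=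
  withDensity_absolutelyContinuous _ _ Real.volume_singleton

/-- The numerical consequences of the two conditions on `α`. -/
theorem vertexCoord_bounds {α ω₁ ω₂ v : ℝ} (hα0 : 0 < α) (hα1 : α < 1) (hω₁ : 1 < ω₁)
    (hω : ω₁ ≤ ω₂) (hlow : (ω₂ - ω₁) / (ω₂ - 1) < α / (1 - α))
    (hupp : α / (1 - α) < ω₂ / (ω₂ - ω₁ + 1)) (hv : v = (ω₂ - α) / (2 * ω₂ - ω₁)) :
    1 / 2 ≤ v ∧ v ≤ 1 ∧ 1 - v - α ≤ 0 ∧ α - (1 - v) * ω₁ ≤ 0 := by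
  have hd : 0 < 2 * ω₂ - ω₁ := by linarith
  rw [div_lt_div_iff₀ (by linarith) (by linarith)] at hlow hupp
  -- The upper condition reads `α(2ω₂ - ω₁ + 1) < ω₂`; if `2α > ω₁` it would contradict `(ω₁ -
  -- 1)(2ω₂ - ω₁) ≥ 0`. This yields `v ≥ 1/2` and the last inequality, while the lower condition is
  -- equivalent to `1 - v < α`.
  have h2α : 2 * α ≤ ω₁ := by
    by_contra! hlt
    nlinarith [mul_nonneg (sub_nonneg.2 hω) (sub_nonneg.2 hω₁.le),
      mul_pos (sub_pos.2 hlt) (show 0 < 2 * ω₂ - ω₁ + 1 by linarith)]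
  have e : 1 - v = (ω₂ - ω₁ + α) / (2 * ω₂ - ω₁) := by
    rw [hv, eq_div_iff hd.ne', sub_mul, div_mul_cancel₀ _ hd.ne']; ring
  refine ⟨?_, ?_, ?_, ?_⟩
  · rw [hv, le_div_iff₀ hd]; linarith
  · rw [hv, div_le_one hd]; linarith
  · rw [e, sub_nonpos, div_le_iff₀ hd]; nlinarith
  · rw [e, sub_nonpos, div_mul_eq_mul_div, le_div_iff₀ hd]
    nlinarith [mul_nonneg (sub_nonneg.2 hω) (sub_nonneg.2 h2α)]

namespace CurveHypothesis

variable {γ : ℝ → ℝ}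

theorem exists_boundedAt (h : CurveHypothesis γ) {α : ℝ} (hα0 : 0 < α) (hα1 : α < 1)
    (hlow : (omegaInftySup γ - omegaInftyInf γ) / (omegaInftySup γ - 1) < α / (1 - α))
    (hupp : α / (1 - α) < omegaInftySup γ / (omegaInftySup γ - omegaInftyInf γ + 1))
    {P : ℝ × ℝ × ℝ} (hP : P ∈ openHull α γ) :
    (0 < P.1 ∧ 0 < P.2.1 ∧ 0 < P.2.2) ∧ ∃ K : ℝ, 0 < K ∧
      BoundedAt (curveOp ((Ioi 0).indicator γ) ((powerMeasure α).restrict (Ioi 0))) K P := by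
  have hω₀ := h.one_lt_omegaZeroSup
  have hω₀₁ := h.omegaZeroSup_le
  have hω₁ := hω₀.trans_le hω₀₁
  have hω₁₂ := h.omegaInftyInf_le
  obtain ⟨hv0, hv1, hv2, hv3⟩ := vertexCoord_bounds hα0 hα1 hω₁ hω₁₂ hlow hupp
    (v := vertexCoord α γ) rfl
  have hm := h.measurable_indicator
  obtain ⟨t₀, c, ht₀, hc, hn1, hn2, hn3⟩ := h.exists_turning_point
  set v := vertexCoord α γ with hv
  have hc₁0 : 0 ≤ α / omegaInftyInf γ := by positivity
  have hc₂0 : 0 ≤ α / omegaZeroSup γ := by positivity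
  have hc₁1 : α / omegaInftyInf γ ≤ 1 := (div_le_one (by linarith)).2 (by linarith)
  have hc₂1 : α / omegaZeroSup γ ≤ 1 := (div_le_one (by linarith)).2 (by linarith)
  have hc₁ω : α / omegaInftyInf γ * omegaInftyInf γ = α := div_mul_cancel₀ _ (by linarith)
  have hc₂ω : α / omegaZeroSup γ * omegaZeroSup γ = α := div_mul_cancel₀ _ (by linarith)
  have hc₁₂ : α / omegaInftyInf γ ≤ α / omegaZeroSup γ := by gcongr
  have hvert : ∀ (μ : ℕ → Measure ℝ) (s e₁ e₂ e₃ e₄ : ℝ),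
      BasicGrowth ((Ioi 0).indicator γ) μ s e₁ e₂ e₃ e₄ → α * e₁ + (1 - α) * s ≤ 0 →
      α / omegaInftyInf γ * e₂ + (1 - α / omegaInftyInf γ) * s ≤ 0 →
      α / omegaZeroSup γ * e₂ + (1 - α / omegaZeroSup γ) * s ≤ 0 →
      (1 - v) * e₃ + (2 * v - 1) * e₄ + (1 - v) * s ≤ 0 →
      ∀ Q ∈ vertices α γ, GrowthAt ((Ioi 0).indicator γ) μ 0 Q := by
    intro μ s e₁ e₂ e₃ e₄ hb h1 h2 h3 h4
    have k1 := hb.growthAt_first hm hα0.le hα1.le h1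
    have k2 := hb.growthAt_second hm hc₁0 hc₁1 h2
    have k3 := hb.growthAt_second hm hc₂0 hc₂1 h3
    have k4 := hb.growthAt_third hm hv0 hv1 h4
    rintro Q (rfl | rfl | rfl | rfl | rfl | rfl | rfl | rfl)
    exacts [k1.1, k1.2, k2.1, k3.1, k2.2, k3.2, k4.1, k4.2]
  have hle1 : ∀ k : ℕ, (2 : ℝ) ^ (-(k : ℝ)) ≤ 1 := fun k =>
    Real.rpow_le_one_of_one_le_of_nonpos (by norm_num) (by simp)
  have hsmall := h.basicGrowth_small (α := α) hα1.le (T := t₀ / 4) (by positivity) hc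
    (fun t ht htt => hn1 t ht (by linarith))
  have hlarge := h.basicGrowth_large (α := α) hα1.le (T := 2 * t₀) (by positivity) hc hn2
  have hleft := h.basicGrowth_middle (α := α) hα1.le ht₀ hc (T := t₀ / 4) (by positivity) hn3
    (a := fun k => t₀ - 2 * (t₀ / 4 * 2 ^ (-(k : ℝ)))) (b := fun k => t₀ - t₀ / 4 * 2 ^ (-(k : ℝ)))
    (fun k => by nlinarith [hle1 k])
    (fun k => by have : (0 : ℝ) < t₀ / 4 * 2 ^ (-(k : ℝ)) := by positivity
                 linarith)
    (fun k => by ring) (fun k t ht => by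
      rw [abs_sub_comm]; refine le_trans ?_ (le_abs_self _); linarith [ht.2])
  have hright := h.basicGrowth_middle (α := α) hα1.le ht₀ hc (T := t₀ / 2) (by positivity) hn3
    (a := fun k => t₀ + t₀ / 2 * 2 ^ (-(k : ℝ))) (b := fun k => t₀ + 2 * (t₀ / 2 * 2 ^ (-(k : ℝ))))
    (fun k => by have : (0 : ℝ) < t₀ / 2 * 2 ^ (-(k : ℝ)) := by positivity
                 linarith)
    (fun k => by nlinarith [hle1 k])
    (fun k => by ring) (fun k t ht => by
      refine le_trans ?_ (le_abs_self _); linarith [ht.1])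
  -- The points of decay are the origin near 0 (rate `-α`) and near `t₀` (rate `-1`), and (1,0,0)
  -- near infinity (rate `α - 1`).
  have bsmall := exists_boundedAt_tsum hm (hvert _ _ _ _ _ _ hsmall (by linarith) (by nlinarith)
    (by nlinarith) (by linarith)) (by linarith) hsmall.zero_zero_zero hP
  have blarge := exists_boundedAt_tsum hm (hvert _ _ _ _ _ _ hlarge (by linarith) (by nlinarith)
    (by nlinarith) (by linarith)) (by linarith) hlarge.one_zero_zero hP
  have bleft := exists_boundedAt_tsum hm (hvert _ _ _ _ _ _ hleft (by linarith) (by linarith)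
    (by linarith) (by linarith)) (by linarith) hleft.zero_zero_zero hP
  have bright := exists_boundedAt_tsum hm (hvert _ _ _ _ _ _ hright (by linarith) (by linarith)
    (by linarith) (by linarith)) (by linarith) hright.zero_zero_zero hP
  -- The hull lies in the closed positive orthant and contains `P - s(1,1,1)` for small `s > 0`.
  -- Positive coordinates mean that `p`, `q`, `r` are finite and nonzero.
  have hpos : 0 < P.1 ∧ 0 < P.2.1 ∧ 0 < P.2.2 := by
    have hsub : convexHull ℝ (vertices α γ) ⊆ Ici 0 := convexHull_min
      (fun Q hQ => (hvert _ _ _ _ _ _ hleft (by linarith) (by linarith) (by linarith)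
        (by linarith) Q hQ).1) (convex_Ici 0)
    have hcont : Tendsto (fun s : ℝ => P - s • ((1, 1, 1) : ℝ × ℝ × ℝ)) (𝓝[>] 0) (𝓝 P) := by
      have : Continuous fun s : ℝ => P - s • ((1, 1, 1) : ℝ × ℝ × ℝ) := by fun_prop
      simpa using (this.tendsto 0).mono_left nhdsWithin_le_nhds
    obtain ⟨s, hsP, hs⟩ := ((hcont.eventually (mem_interior_iff_mem_nhds.1 hP)).and
      self_mem_nhdsWithin).exists
    replace hs : 0 < s := hs
    obtain ⟨h1, h2, h3⟩ := hsub hsP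
    simp at h1 h2 h3
    exact ⟨by linarith, by linarith, by linarith⟩
  refine ⟨hpos, ?_⟩
  obtain ⟨K, hK, hB⟩ := BoundedAt.add hpos.2.2.le (BoundedAt.add hpos.2.2.le bsmall blarge)
    (BoundedAt.add hpos.2.2.le bleft bright)
  refine ⟨K, hK, fun F G hF hG hF1 hG1 => ?_⟩
  obtain ⟨M, hM, hM1, hT⟩ := hB F G hF hG hF1 hG1
  refine ⟨M, hM, hM1, fun x => le_trans ?_ (hT x)⟩
  have hcover : Ioi (0 : ℝ) ⊆ {t₀} ∪
      (((⋃ k : ℕ, Ioc (t₀ / 4 * 2 ^ (-(k : ℝ))) (2 * (t₀ / 4 * 2 ^ (-(k : ℝ))))) ∪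
        (⋃ k : ℕ, Ioc (2 * t₀ * 2 ^ (k : ℝ)) (2 * (2 * t₀ * 2 ^ (k : ℝ))))) ∪
      ((⋃ k : ℕ, Ioc (t₀ - 2 * (t₀ / 4 * 2 ^ (-(k : ℝ)))) (t₀ - t₀ / 4 * 2 ^ (-(k : ℝ)))) ∪
        (⋃ k : ℕ, Ioc (t₀ + t₀ / 2 * 2 ^ (-(k : ℝ))) (t₀ + 2 * (t₀ / 2 * 2 ^ (-(k : ℝ))))))) := by
    intro t ht
    replace ht : 0 < t := ht
    simp only [mem_union, mem_iUnion, mem_singleton_iff]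
    rcases le_or_gt t (t₀ / 2) with h1 | h1
    · exact Or.inr (Or.inl (Or.inl (exists_mem_Ioc_half_pow ht (by linarith))))
    rcases lt_trichotomy t t₀ with h2 | h2 | h2
    · obtain ⟨k, hk1, hk2⟩ := exists_mem_Ico_half_pow (x := t₀ - t) (T := t₀ / 4) (by linarith)
        (by linarith)
      exact Or.inr (Or.inr (Or.inl ⟨k, by linarith, by linarith⟩))
    · exact Or.inl h2
    rcases le_or_gt t (2 * t₀) with h3 | h3
    · obtain ⟨k, hk1, hk2⟩ := exists_mem_Ioc_half_pow (x := t - t₀) (T := t₀ / 2) (by linarith)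
        (by linarith)
      exact Or.inr (Or.inr (Or.inr ⟨k, by linarith, by linarith⟩))
    · exact Or.inr (Or.inl (Or.inr (exists_mem_Ioc_two_pow (by positivity) h3)))
  unfold curveOp
  refine (lintegral_mono_set hcover).trans ((lintegral_union_le _ _ _).trans ?_)
  rw [Measure.restrict_zero_set (powerMeasure_singleton α t₀), lintegral_zero_measure, zero_add]
  refine (lintegral_union_le _ _ _).trans (add_le_add ((lintegral_union_le _ _ _).trans
    (add_le_add ?_ ?_)) ((lintegral_union_le _ _ _).trans (add_le_add ?_ ?_))) <;>
  exact lintegral_iUnion_le _ _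

end CurveHypothesis

/-! ### From factorized bounds to norms and almost everywhere convergence -/

theorem measurable_curveOp {F G : ℝ → ℝ≥0∞} (hF : Measurable F) (hG : Measurable G)
    {γ : ℝ → ℝ} (hγ : Measurable γ) (μ : Measure ℝ) [SFinite μ] :
    Measurable (curveOp γ μ F G) :=
  Measurable.lintegral_prod_right' (f := fun p : ℝ × ℝ => F (p.1 - p.2) * G (p.1 - γ p.2))
    (by fun_prop)

theorem curveOp_const_mul {A B : ℝ≥0∞} (hA : A ≠ ⊤) (hB : B ≠ ⊤) (γ : ℝ → ℝ) (μ : Measure ℝ)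
    (F G : ℝ → ℝ≥0∞) (x : ℝ) :
    curveOp γ μ (fun y => A * F y) (fun y => B * G y) x = A * B * curveOp γ μ F G x := by
  unfold curveOp
  rw [← lintegral_const_mul' _ _ (ENNReal.mul_ne_top hA hB)]
  refine lintegral_congr fun t => ?_
  ring

theorem lintegral_div_rpow_le_one {F : ℝ → ℝ≥0∞} {A : ℝ≥0∞} (hA0 : A ≠ 0) (hA : A ≠ ⊤) {u : ℝ}
    (hu : 0 < u) (h : (∫⁻ x, F x ^ (1 / u)) ^ u ≤ A) :
    ∫⁻ x, (A⁻¹ * F x) ^ (1 / u) ≤ 1 := by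
  have hu' : 0 ≤ 1 / u := by positivity
  simp only [ENNReal.mul_rpow_of_nonneg _ _ hu']
  rw [lintegral_const_mul' _ _ (ENNReal.rpow_ne_top_of_nonneg hu' (ENNReal.inv_ne_top.2 hA0))]
  have h1 : ∫⁻ x, F x ^ (1 / u) ≤ A ^ (1 / u) := by
    have := ENNReal.rpow_le_rpow h hu'
    rwa [← ENNReal.rpow_mul, mul_one_div_cancel hu.ne', ENNReal.rpow_one] at this
  calc _ ≤ A⁻¹ ^ (1 / u) * A ^ (1 / u) := by gcongr
    _ = 1 := by
      rw [← ENNReal.mul_rpow_of_nonneg _ _ hu', ENNReal.inv_mul_cancel hA0 hA, ENNReal.one_rpow]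

/-- The norm inequality contained in `BoundedAt`. -/
theorem BoundedAt.norm_le {γ : ℝ → ℝ} {μ : Measure ℝ} {K : ℝ} (hK : 0 < K) {u v w : ℝ}
    (hu : 0 < u) (hv : 0 < v) (hw : 0 < w) (h : BoundedAt (curveOp γ μ) K (u, v, w))
    {F G : ℝ → ℝ≥0∞} (hF : Measurable F) (hG : Measurable G)
    (hFt : (∫⁻ x, F x ^ (1 / u)) ^ u ≠ ⊤) (hGt : (∫⁻ x, G x ^ (1 / v)) ^ v ≠ ⊤) :
    (∫⁻ x, curveOp γ μ F G x ^ (1 / w)) ^ w ≤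
      ENNReal.ofReal K * (∫⁻ x, F x ^ (1 / u)) ^ u * (∫⁻ x, G x ^ (1 / v)) ^ v := by
  have hK0 : ENNReal.ofReal K ≠ 0 := by simpa using hK
  have hw' : 0 ≤ 1 / w := by positivity
  suffices hdiv : (∫⁻ x, curveOp γ μ F G x ^ (1 / w)) ^ w / ENNReal.ofReal K ≤
      (∫⁻ x, F x ^ (1 / u)) ^ u * (∫⁻ x, G x ^ (1 / v)) ^ v by
    rw [ENNReal.div_le_iff_le_mul (Or.inl hK0) (Or.inl ENNReal.ofReal_ne_top)] at hdiv
    exact hdiv.trans (le_of_eq (by ring))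
  -- Normalizing by any `A`, `B` strictly above the two norms, rather than by the norms, avoids
  -- dividing by zero.
  refine ENNReal.le_mul_of_forall_lt (Or.inr hGt) (Or.inl hFt) fun A hA B hB => ?_
  have hA0 : A ≠ 0 := hA.ne_bot
  have hB0 : B ≠ 0 := hB.ne_bot
  by_cases hAt : A = ⊤
  · simp [hAt, ENNReal.top_mul hB0]
  by_cases hBt : B = ⊤
  · simp [hBt, ENNReal.mul_top hA0]
  obtain ⟨M, -, hM1, hM⟩ := h (fun x => (A⁻¹ * F x) ^ (1 / u)) (fun x => (B⁻¹ * G x) ^ (1 / v))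
    ((hF.const_mul _).pow_const _) ((hG.const_mul _).pow_const _)
    (lintegral_div_rpow_le_one hA0 hAt hu hA.le) (lintegral_div_rpow_le_one hB0 hBt hv hB.le)
  simp only [← ENNReal.rpow_mul, one_div_mul_cancel hu.ne', one_div_mul_cancel hv.ne',
    ENNReal.rpow_one] at hM
  have hM' : ∀ x, curveOp γ μ F G x ≤ A * B * ENNReal.ofReal K * M x ^ w := by
    intro x
    have := hM x
    rw [curveOp_const_mul (ENNReal.inv_ne_top.2 hA0) (ENNReal.inv_ne_top.2 hB0)] at this
    calc curveOp γ μ F G x = (A * A⁻¹) * (B * B⁻¹) * curveOp γ μ F G x := by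
          rw [ENNReal.mul_inv_cancel hA0 hAt, ENNReal.mul_inv_cancel hB0 hBt, one_mul, one_mul]
      _ = A * B * (A⁻¹ * B⁻¹ * curveOp γ μ F G x) := by ring
      _ ≤ A * B * (ENNReal.ofReal K * M x ^ w) := by gcongr
      _ = _ := by ring
  have hct : A * B * ENNReal.ofReal K ≠ ⊤ :=
    ENNReal.mul_ne_top (ENNReal.mul_ne_top hAt hBt) ENNReal.ofReal_ne_top
  rw [ENNReal.div_le_iff_le_mul (Or.inl hK0) (Or.inl ENNReal.ofReal_ne_top)]
  calc (∫⁻ x, curveOp γ μ F G x ^ (1 / w)) ^ w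
      ≤ (∫⁻ x, (A * B * ENNReal.ofReal K) ^ (1 / w) * M x) ^ w := by
        gcongr with x
        refine (ENNReal.rpow_le_rpow (hM' x) hw').trans (le_of_eq ?_)
        rw [ENNReal.mul_rpow_of_nonneg _ _ hw', ← ENNReal.rpow_mul, mul_one_div_cancel hw.ne',
          ENNReal.rpow_one]
    _ ≤ ((A * B * ENNReal.ofReal K) ^ (1 / w) * 1) ^ w := by
        rw [lintegral_const_mul' _ _ (ENNReal.rpow_ne_top_of_nonneg hw' hct)]
        gcongr
    _ = A * B * ENNReal.ofReal K := by
        rw [mul_one, ← ENNReal.rpow_mul, one_div_mul_cancel hw.ne', ENNReal.rpow_one]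

/-- For each fixed `t` the exceptional set of `x` is a translate of a null set, so Fubini applies
whatever the measurable curve `φ` is. This allows `f` and `g` to be replaced by measurable
representatives. -/
theorem ae_ae_comp_sub {φ : ℝ → ℝ} (hφ : Measurable φ) {p : ℝ → Prop} (hp : ∀ᵐ x, p x)
    (S : Set ℝ) : ∀ᵐ x : ℝ, ∀ᵐ t ∂(volume.restrict S), p (x - φ t) := by
  set N := toMeasurable volume {x | ¬p x}
  have hN : MeasurableSet N := measurableSet_toMeasurable _ _
  have hN0 : volume N = 0 := (measure_toMeasurable _).trans (ae_iff.1 hp)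
  have hF : Measurable (N.indicator (1 : ℝ → ℝ≥0∞)) := measurable_one.indicator hN
  have h0 := lintegral_setLIntegral_comp_sub hF hφ S
  rw [lintegral_indicator_one hN, hN0, mul_zero,
    lintegral_eq_zero_iff (measurable_setLIntegral_comp_sub hF hφ S)] at h0
  filter_upwards [h0] with x hx
  have hx' := (lintegral_eq_zero_iff (by fun_prop)).1 hx
  filter_upwards [hx'] with t ht
  by_contra hcon
  have : x - φ t ∈ N := subset_toMeasurable _ _ hcon
  simp [this] at ht

theorem toReal_inv_pos {p : ℝ≥0∞} (h : 0 < (1 / p).toReal) :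
    p ≠ 0 ∧ p ≠ ⊤ ∧ 1 / p.toReal = (1 / p).toReal ∧ p.toReal = 1 / (1 / p).toReal := by
  refine ⟨?_, ?_, ?_, ?_⟩
  · rintro rfl; simp at h
  · rintro rfl; simp at h
  · simp
  · simp

theorem integral_integrand_enorm {α : ℝ} {γ : ℝ → ℝ} (hγ : Measurable γ) {f g : ℝ → ℂ}
    (hf : Measurable f) (hg : Measurable g) (x : ℝ) :
    ∫⁻ t in Ioi 0, ‖integrand α γ f g x t‖ₑ =
      curveOp γ ((powerMeasure α).restrict (Ioi 0)) (fun y => ‖f y‖ₑ) (fun y => ‖g y‖ₑ) x := by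
  rw [curveOp, powerMeasure, restrict_withDensity measurableSet_Ioi,
    lintegral_withDensity_eq_lintegral_mul _ (by fun_prop) (by fun_prop)]
  refine setLIntegral_congr_fun measurableSet_Ioi fun t ht => ?_
  replace ht : 0 < t := ht
  have hpos : 0 < t ^ (1 - α) := Real.rpow_pos_of_pos ht _
  have e : ‖(((t ^ (1 - α) : ℝ) : ℂ))⁻¹‖ₑ = ENNReal.ofReal (t ^ (α - 1)) := by
    rw [← ofReal_norm, norm_inv, Complex.norm_real, Real.norm_of_nonneg hpos.le,
      ← Real.rpow_neg ht.le, neg_sub]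
  simp only [integrand, Pi.mul_apply, div_eq_mul_inv, enorm_mul]
  rw [e, mul_comm]

end BilinearCurve

end

theorem theorem1p1 (α : ℝ) (hα0 : 0 < α) (hα1 : α < 1)
    (γ : ℝ → ℝ) (hγ : BilinearCurve.CurveHypothesis γ)
    (hlow : (BilinearCurve.omegaInftySup γ - BilinearCurve.omegaInftyInf γ) /
      (BilinearCurve.omegaInftySup γ - 1) < α / (1 - α))
    (hupp : α / (1 - α) < BilinearCurve.omegaInftySup γ /
      (BilinearCurve.omegaInftySup γ - BilinearCurve.omegaInftyInf γ + 1))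
    (p q r : ENNReal)
    (hpqr : ((1 / p).toReal, (1 / q).toReal, (1 / r).toReal) ∈ BilinearCurve.openHull α γ) :
    ∃ C : ℝ, 0 < C ∧ ∀ f g : ℝ → ℂ,
      MeasureTheory.MemLp f p MeasureTheory.volume →
      MeasureTheory.MemLp g q MeasureTheory.volume →
        (∀ᵐ x : ℝ, MeasureTheory.IntegrableOn
          (fun t : ℝ => BilinearCurve.integrand α γ f g x t) (Set.Ioi 0)) ∧
        MeasureTheory.MemLp (BilinearCurve.bilinearFractionalIntegral α γ f g) r
          MeasureTheory.volume ∧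
        MeasureTheory.eLpNorm (BilinearCurve.bilinearFractionalIntegral α γ f g) r
            MeasureTheory.volume ≤
          ENNReal.ofReal C * MeasureTheory.eLpNorm f p MeasureTheory.volume *
            MeasureTheory.eLpNorm g q MeasureTheory.volume := by
  open BilinearCurve in
  obtain ⟨⟨hu, hv, hw⟩, K, hK, hB⟩ := hγ.exists_boundedAt hα0 hα1 hlow hupp hpqr
  simp only at hu hv hw
  obtain ⟨hp0, hpt, hp1, hp2⟩ := toReal_inv_pos hu
  obtain ⟨hq0, hqt, hq1, hq2⟩ := toReal_inv_pos hv
  obtain ⟨hr0, hrt, hr1, hr2⟩ := toReal_inv_pos hw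
  refine ⟨K, hK, fun f g hf hg => ?_⟩
  set δ : ℝ → ℝ := (Ioi 0).indicator γ with hδ
  have hδm : Measurable δ := hγ.measurable_indicator
  set f' := hf.1.mk f with hf'
  set g' := hg.1.mk g with hg'
  have hf'm : Measurable f' := hf.1.measurable_mk
  have hg'm : Measurable g' := hg.1.measurable_mk
  set H : ℝ → ENNReal := curveOp δ ((powerMeasure α).restrict (Ioi 0))
    (fun y => ‖f' y‖ₑ) (fun y => ‖g' y‖ₑ) with hH
  have hHm : Measurable H := by
    have : SFinite ((powerMeasure α).restrict (Ioi 0)) := by unfold powerMeasure; infer_instance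
    exact measurable_curveOp (by fun_prop) (by fun_prop) hδm _
  have hfn : eLpNorm f p volume =
      (∫⁻ x, ‖f' x‖ₑ ^ (1 / (1 / p).toReal)) ^ (1 / p).toReal := by
    rw [eLpNorm_congr_ae hf.1.ae_eq_mk, eLpNorm_eq_lintegral_rpow_enorm_toReal hp0 hpt, hp1, hp2]
  have hgn : eLpNorm g q volume =
      (∫⁻ x, ‖g' x‖ₑ ^ (1 / (1 / q).toReal)) ^ (1 / q).toReal := by
    rw [eLpNorm_congr_ae hg.1.ae_eq_mk, eLpNorm_eq_lintegral_rpow_enorm_toReal hq0 hqt, hq1, hq2]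
  have hHn : eLpNorm H r volume = (∫⁻ x, H x ^ (1 / (1 / r).toReal)) ^ (1 / r).toReal := by
    rw [eLpNorm_eq_lintegral_rpow_enorm_toReal hr0 hrt, hr1, hr2]
    simp only [enorm_eq_self]
  have hbound : eLpNorm H r volume ≤
      ENNReal.ofReal K * eLpNorm f p volume * eLpNorm g q volume := by
    rw [hHn, hfn, hgn]
    exact hB.norm_le hK hu hv hw (by fun_prop) (by fun_prop) (hfn ▸ hf.2.ne) (hgn ▸ hg.2.ne)
  have hfin : eLpNorm H r volume < ⊤ := hbound.trans_lt
    (ENNReal.mul_lt_top (ENNReal.mul_lt_top ENNReal.ofReal_lt_top hf.2) hg.2)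
  -- `H` is the integral of the absolute value, so its finiteness almost everywhere is the absolute
  -- convergence claimed.
  have hHfin : ∀ᵐ x, H x < ⊤ := by
    rw [hHn, ENNReal.rpow_lt_top_iff_of_pos hw] at hfin
    filter_upwards [ae_lt_top (by fun_prop) hfin.ne] with x hx
    rwa [ENNReal.rpow_lt_top_iff_of_pos (by positivity)] at hx
  have hae : ∀ᵐ x : ℝ, integrand α γ f g x =ᵐ[volume.restrict (Ioi 0)]
      integrand α δ f' g' x := by
    filter_upwards [ae_ae_comp_sub measurable_id hf.1.ae_eq_mk (Ioi 0),
      ae_ae_comp_sub hδm hg.1.ae_eq_mk (Ioi 0)] with x h1 h2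
    filter_upwards [h1, h2, ae_restrict_mem measurableSet_Ioi] with t h3 h4 ht
    have ht' : δ t = γ t := indicator_of_mem ht γ
    simp only [id] at h3
    rw [ht'] at h4
    simp only [integrand, ht']
    rw [h3, h4]
  have hjoint : Measurable (Function.uncurry (integrand α δ f' g')) := by
    have : Function.uncurry (integrand α δ f' g') = fun z : ℝ × ℝ =>
        f' (z.1 - z.2) * g' (z.1 - δ z.2) / ((z.2 ^ (1 - α) : ℝ) : ℂ) := rfl
    rw [this]
    fun_prop
  have heq : bilinearFractionalIntegral α γ f g =ᵐ[volume]
      bilinearFractionalIntegral α δ f' g' := by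
    filter_upwards [hae] with x hx
    exact integral_congr_ae hx
  have hle : eLpNorm (bilinearFractionalIntegral α γ f g) r volume ≤ eLpNorm H r volume := by
    rw [eLpNorm_congr_ae heq]
    refine eLpNorm_mono_enorm_ae (Eventually.of_forall fun x => ?_)
    refine (enorm_integral_le_lintegral_enorm _).trans (le_of_eq ?_)
    rw [integral_integrand_enorm hδm hf'm hg'm, enorm_eq_self]
  refine ⟨?_, ⟨?_, hle.trans_lt hfin⟩, hle.trans hbound⟩
  · filter_upwards [hae, hHfin] with x hx hxt
    refine (integrable_congr hx).2 ⟨?_, ?_⟩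
    · exact (hjoint.comp measurable_prodMk_left).aestronglyMeasurable
    · rw [hasFiniteIntegral_iff_enorm, integral_integrand_enorm hδm hf'm hg'm]
      exact hxt
  · exact (StronglyMeasurable.integral_prod_right
      hjoint.stronglyMeasurable).aestronglyMeasurable.congr heq.symm
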